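/- A \emph{unit loop} is a closed curve $\gamma:[0,1]\to\mathbb{R}^3$, $\gamma(0)=\gamma(1)$, that is Lipschitz continuous with $|\gamma'|=1$ almost everywhere, whose trace (again denoted by $\gamma$) contains the origin and has one-dimensional Hausdorff measure $\mathcal{H}^1(\gamma)=1$. It is \emph{simple} if $\gamma$ is injective on $[0,1)$. The \emph{knot type} of a simple closed curve is the ambient isotopy class of its trace in $\mathbb{R}^3$. For three points $x,y,z\in\mathbb{R}^3$ let $R(x,y,z)\in(0,\infty]$ be the radius of the circle through them ($R=\infty$ if they are collinear), and put $$\varrho[\gamma](x,y)=\inf_{z} R(x,y,z),\qquad \varrho_G[\gamma](x)=\inf_{y,z}R(x,y,z),$$ where the infima are over points $z\in\gamma$, respectively $y,z\in\gamma$, such that $x,y,z$ are pairwise distinct. For almost every $x\in\gamma$ the curve has a tangent line $\ell_x$ at $x$; let $r_{\rm tp}[\gamma](x,y)=|x-y|^2/\bigl(2\,\mathrm{dist}(y,\ell_x)\bigr)\in(0,\infty]$ (for $y\neq x$) be the radius of the circle through $x$ and $y$ that is tangent to $\gamma$ at $x$. Integrating with respect to $\mathcal{H}^1$, consider $$\mathscr{M}_p(\gamma)=\int_\gamma\int_\gamma\int_\gamma\frac{d\mathcal{H}^1(x)\,d\mathcal{H}^1(y)\,d\mathcal{H}^1(z)}{R(x,y,z)^p},\qquad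 \mathscr{I}_p(\gamma)=\int_\gamma\int_\gamma\frac{d\mathcal{H}^1(x)\,d\mathcal{H}^1(y)}{\varrho[\gamma](x,y)^p},\qquad \mathscr{U}_p(\gamma)=\int_\gamma\frac{d\mathcal{H}^1(x)}{\varrho_G[\gamma](x)^p},$$ $$\mathscr{E}_p(\gamma)=\int_\gamma\int_\gamma\frac{d\mathcal{H}^1(x)\,d\mathcal{H}^1(y)}{r_{\rm tp}[\gamma](x,y)^p},\qquad \mathscr{E}^{\rm sym}_p(\gamma)=\int_\gamma\int_\gamma\frac{d\mathcal{H}^1(x)\,d\mathcal{H}^1(y)}{\bigl(r_{\rm tp}[\gamma](x,y)\,r_{\rm tp}[\gamma](y,x)\bigr)^{p/2}}.$$ \textbf{Corollary.} Let $\mathscr{F}$ be one of the energies $\mathscr{M}_p$ with $p>3$, $\mathscr{I}_p$ with $p>2$, $\mathscr{U}_p$ with $p>1$, $\mathscr{E}_p$ with $p>2$, or $\mathscr{E}^{\rm sym}_p$ with $p>2$. Then for every $E\in[0,\infty)$ only finitely many knot types have a representative that is a simple unit loop $\gamma$ with $\mathscr{F}(\gamma)\le E$. -/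

import Mathlib

open Set MeasureTheory
open scoped ENNReal NNReal unitInterval

noncomputable section

namespace MengerKnot

/-- Euclidean three-space. -/
abbrev E3 : Type := EuclideanSpace ℝ (Fin 3)

/-! ### Knots, ambient isotopy, knot types -/

/-- `γ : [0,1] → ℝ³` is a simple closed curve; only the values on `[0,1]` matter. -/
structure IsSimpleClosed (γ : ℝ → E3) : Prop where
  continuousOn : ContinuousOn γ (Icc 0 1)
  closed : γ 0 = γ 1
  injOn : InjOn γ (Ico 0 1)

/-- The curve `γ`, regarded as a subset of `ℝ³`. -/
def trace (γ : ℝ → E3) : Set E3 := γ '' Icc 0 1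

/-- A knot: a subset of `ℝ³` which is the trace of a simple closed curve. -/
def Knot : Type := {K : Set E3 // ∃ γ : ℝ → E3, IsSimpleClosed γ ∧ K = trace γ}

/-- Two subsets of `ℝ³` are ambient isotopic: there is a continuous family of homeomorphisms of
`ℝ³` which starts at the identity and whose last member maps the first set onto the second. -/
def AmbientIsotopic (K L : Set E3) : Prop :=
  ∃ H : I → (E3 ≃ₜ E3), Continuous (fun q : I × E3 => H q.1 q.2) ∧
    H 0 = Homeomorph.refl E3 ∧ H 1 '' K = L

theorem AmbientIsotopic.refl (K : Set E3) : AmbientIsotopic K K :=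
  ⟨fun _ => Homeomorph.refl E3, continuous_snd, rfl, by simp⟩

theorem AmbientIsotopic.symm {K L : Set E3} (h : AmbientIsotopic K L) : AmbientIsotopic L K := by
  obtain ⟨H, hc, h0, h1⟩ := h
  refine ⟨fun t => (H 1).symm.trans (H (unitInterval.symm t)), ?_, ?_, ?_⟩
  · have : Continuous fun q : I × E3 => (unitInterval.symm q.1, (H 1).symm q.2) := by fun_prop
    exact hc.comp this
  · ext1 x
    simp
  · subst h1
    ext x
    simp [h0]

theorem AmbientIsotopic.trans {K L M : Set E3} (h : AmbientIsotopic K L)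
    (h' : AmbientIsotopic L M) : AmbientIsotopic K M := by
  obtain ⟨H, hc, h0, h1⟩ := h
  obtain ⟨G, gc, g0, g1⟩ := h'
  refine ⟨fun t => (H t).trans (G t), ?_, ?_, ?_⟩
  · have : Continuous fun q : I × E3 => (q.1, H q.1 q.2) := continuous_fst.prodMk hc
    exact gc.comp this
  · ext1 x
    simp [h0, g0]
  · subst h1
    subst g1
    rw [image_image]
    rfl

/-- Ambient isotopy as an equivalence relation on knots. -/
instance knotSetoid : Setoid Knot where
  r K L := AmbientIsotopic K.1 L.1
  iseqv := ⟨fun K => AmbientIsotopic.refl K.1, fun h => h.symm, fun h h' => h.trans h'⟩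

/-- Knot types: ambient isotopy classes of knots. -/
def KnotType : Type := Quotient knotSetoid

/-- The knot type of a simple closed curve. -/
def knotType (γ : ℝ → E3) (hγ : IsSimpleClosed γ) : KnotType :=
  Quotient.mk knotSetoid ⟨trace γ, γ, hγ, rfl⟩

/-! ### Unit loops -/

/-- The class of unit loops: closed curves `γ : [0,1] → ℝ³` that are Lipschitz with `|γ'| = 1`
almost everywhere, whose trace has one-dimensional Hausdorff measure one and contains the origin.
Only the values of `γ` on `[0,1]` matter. -/
structure IsUnitLoop (γ : ℝ → E3) : Prop where
  lipschitz : ∃ L : ℝ≥0, LipschitzOnWith L γ (Icc 0 1)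
  unitSpeed : ∀ᵐ s ∂(volume.restrict (Icc (0 : ℝ) 1)), ‖deriv γ s‖ = 1
  closed : γ 0 = γ 1
  hausdorff : μH[1] (trace γ) = 1
  origin : (0 : E3) ∈ trace γ

/-! ### Radii -/

open Classical in
/-- The circumradius `R(x,y,z)` of three points; it is infinite if the points are collinear. -/
def circumradius (x y z : E3) : ℝ≥0∞ :=
  if h : AffineIndependent ℝ ![x, y, z] then
    ENNReal.ofReal (Affine.Simplex.circumradius (⟨![x, y, z], h⟩ : Affine.Simplex ℝ E3 2))
  else ∞

/-- `ϱ[γ](x,y)`: the infimum of `R(x,y,z)` over `z ∈ γ` with `x, y, z` pairwise distinct. -/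
def rho (γ : ℝ → E3) (x y : E3) : ℝ≥0∞ :=
  ⨅ (z : E3) (_ : z ∈ trace γ) (_ : x ≠ y ∧ y ≠ z ∧ z ≠ x), circumradius x y z

/-- The global radius of curvature `ϱ_G[γ](x)`: the infimum of `R(x,y,z)` over `y, z ∈ γ` with
`x, y, z` pairwise distinct. -/
def rhoG (γ : ℝ → E3) (x : E3) : ℝ≥0∞ :=
  ⨅ (y : E3) (_ : y ∈ trace γ) (z : E3) (_ : z ∈ trace γ) (_ : x ≠ y ∧ y ≠ z ∧ z ≠ x),
    circumradius x y z

/-- The tangent line `x + ℝ γ'(t)` of `γ` at the point `x = γ(t)`. For a unit loop this is a line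
for almost every `x` on the curve (there is exactly one parameter `t`, and `γ` is differentiable
there with `|γ'(t)| = 1`). -/
def tangentLine (γ : ℝ → E3) (x : E3) : Set E3 :=
  {w | ∃ t ∈ Ioo (0 : ℝ) 1, γ t = x ∧ DifferentiableAt ℝ γ t ∧ ∃ τ : ℝ, w = x + τ • deriv γ t}

/-- The tangent-point radius `r_tp[γ](x,y) = |y - x|² / (2 dist(y, ℓ))`, where `ℓ` is the tangent
line of `γ` at `x`: the radius of the circle through `x` and `y` that is tangent to `γ` at `x`.
It is infinite if `y ≠ x` lies on `ℓ`. -/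
def tangentPointRadius (γ : ℝ → E3) (x y : E3) : ℝ≥0∞ :=
  edist y x ^ 2 / (2 * Metric.infEDist y (tangentLine γ x))

/-! ### Energies -/

/-- The measure on `γ` used in all energies: one-dimensional Hausdorff measure on the trace. -/
def curveMeasure (γ : ℝ → E3) : Measure E3 := (μH[1] : Measure E3).restrict (trace γ)

/-- Integral Menger curvature `ℳ_p(γ) = ∫∫∫ R(x,y,z)^{-p}`. -/
def energyM (p : ℝ) (γ : ℝ → E3) : ℝ≥0∞ :=
  ∫⁻ x, ∫⁻ y, ∫⁻ z, (circumradius x y z ^ p)⁻¹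
    ∂(curveMeasure γ) ∂(curveMeasure γ) ∂(curveMeasure γ)

/-- `ℐ_p(γ) = ∫∫ ϱ[γ](x,y)^{-p}`. -/
def energyI (p : ℝ) (γ : ℝ → E3) : ℝ≥0∞ :=
  ∫⁻ x, ∫⁻ y, (rho γ x y ^ p)⁻¹ ∂(curveMeasure γ) ∂(curveMeasure γ)

/-- `𝒰_p(γ) = ∫ ϱ_G[γ](x)^{-p}`. -/
def energyU (p : ℝ) (γ : ℝ → E3) : ℝ≥0∞ :=
  ∫⁻ x, (rhoG γ x ^ p)⁻¹ ∂(curveMeasure γ)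

/-- The tangent-point energy `ℰ_p(γ) = ∫∫ r_tp[γ](x,y)^{-p}`. -/
def energyTP (p : ℝ) (γ : ℝ → E3) : ℝ≥0∞ :=
  ∫⁻ x, ∫⁻ y, (tangentPointRadius γ x y ^ p)⁻¹ ∂(curveMeasure γ) ∂(curveMeasure γ)

/-- The symmetrized tangent-point energy `∫∫ (r_tp[γ](x,y) r_tp[γ](y,x))^{-p/2}`. -/
def energyTPSym (p : ℝ) (γ : ℝ → E3) : ℝ≥0∞ :=
  ∫⁻ x, ∫⁻ y, ((tangentPointRadius γ x y * tangentPointRadius γ y x) ^ (p / 2))⁻¹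
    ∂(curveMeasure γ) ∂(curveMeasure γ)

/-! ### Finiteness of knot types -/

/-- The knot types that are represented by a simple unit loop of energy at most `E`. -/
def knotTypesBelow (energy : (ℝ → E3) → ℝ≥0∞) (E : ℝ≥0) : Set KnotType :=
  {κ | ∃ (γ : ℝ → E3) (hγ : IsSimpleClosed γ),
    IsUnitLoop γ ∧ energy γ ≤ E ∧ knotType γ hγ = κ}

/-- Only finitely many knot types occur below each (finite) energy level. -/
def FinitelyManyKnotTypes (energy : (ℝ → E3) → ℝ≥0∞) : Prop :=
  ∀ E : ℝ≥0, (knotTypesBelow energy E).Finite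

end MengerKnot

end

namespace MengerKnot

/-! A bound on the energy controls bending at every scale. Let `x, y, z` lie on the curve, `‖y - x‖
= d`, `‖z - x‖` between `d / 4` and `d / 2`, and let `θ` be the sine of the angle at `x`. The
triangle stays as bent when its vertices move by a small multiple of `θ d`, and the curve has arcs
of that length near each vertex. With `n` integrations the energy is therefore at least a constant
times `(θ d) ^ n * (θ / d) ^ p`. As `p > n`, this gives `θ ≤ C d ^ κ` with `κ = (p - n) / (n + p) >
0` (`finitelyManyKnotTypes_of_le_energy`). Summing over dyadic scales, all chords from a common
point of length at most `r` are nearly parallel, with `r` depending only on the energy bound and `p`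
(`exists_isFlat_of_hasAngleDecay`).

A flat loop is almost straight on parameter intervals of length `r`, and no other strand comes near
(`IsArcLoop.exists_direction`). If two flat loops nearly agree on a fine grid, their difference is a
Lipschitz function of the point in space with small constant. It extends to a contraction `u` of
`ℝ³`, and `x + t u(x)` is an ambient isotopy. The grid samples lie in a compact set, so finitely
many classes suffice (`finite_knotTypes_of_isFlat`).

For the tangent-point energies, the tangents near a vertex cannot follow two edges with different
directions. The symmetrized energy only shows that each edge is followed at one of its ends; a
fourth point and a pigeonhole argument compensate for this. -/

/-! ### The sine of the angle between two vectors -/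

/-- The sine of the unoriented angle between two vectors. -/
noncomputable def sinAngle (u v : E3) : ℝ := Real.sin (InnerProductGeometry.angle u v)

theorem sinAngle_comm (u v : E3) : sinAngle u v = sinAngle v u := by
  rw [sinAngle, InnerProductGeometry.angle_comm, sinAngle]

theorem sinAngle_nonneg (u v : E3) : 0 ≤ sinAngle u v :=
  InnerProductGeometry.sin_angle_nonneg u v

theorem sinAngle_le_one (u v : E3) : sinAngle u v ≤ 1 := Real.sin_le_one _

@[simp] theorem sinAngle_zero_left (v : E3) : sinAngle 0 v = 1 := by
  simp [sinAngle]

@[simp] theorem sinAngle_zero_right (v : E3) : sinAngle v 0 = 1 := by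
  simp [sinAngle]

@[simp] theorem sinAngle_neg_right (u v : E3) : sinAngle u (-v) = sinAngle u v := by
  simp [sinAngle, InnerProductGeometry.angle_neg_right, Real.sin_pi_sub]

@[simp] theorem sinAngle_neg_left (u v : E3) : sinAngle (-u) v = sinAngle u v := by
  simp [sinAngle, InnerProductGeometry.angle_neg_left, Real.sin_pi_sub]

theorem sinAngle_smul_right {c : ℝ} (hc : 0 < c) (u v : E3) :
    sinAngle u (c • v) = sinAngle u v := by
  simp [sinAngle, InnerProductGeometry.angle_smul_right_of_pos _ _ hc]

theorem sinAngle_eq_one_of_inner_eq_zero {u v : E3} (h : inner ℝ u v = 0) : sinAngle u v = 1 := by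
  rw [sinAngle, (InnerProductGeometry.inner_eq_zero_iff_angle_eq_pi_div_two u v).1 h]
  simp

theorem sinAngle_sub_comm (x y : E3) (w : E3) : sinAngle (x - y) w = sinAngle (y - x) w := by
  rw [← neg_sub, sinAngle_neg_left]

theorem sq_sinAngle_mul (u v : E3) :
    (sinAngle u v) ^ 2 * (‖u‖ ^ 2 * ‖v‖ ^ 2) = ‖u‖ ^ 2 * ‖v‖ ^ 2 - inner ℝ u v ^ 2 := by
  have h := InnerProductGeometry.cos_angle_mul_norm_mul_norm u v
  have h2 := Real.sin_sq_add_cos_sq (InnerProductGeometry.angle u v)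
  rw [← h, sinAngle, Real.sin_sq]
  ring

/-- Pythagoras for the splitting of `u` along `v`, multiplied by `‖v‖ ^ 2` so that `v = 0` is
allowed. Hence `sinAngle u v * ‖u‖` is the distance from `u` to the line `ℝ v`. -/
theorem sq_norm_sub_smul_mul (u v : E3) (t : ℝ) :
    ‖u - t • v‖ ^ 2 * ‖v‖ ^ 2 =
      (sinAngle u v * ‖u‖) ^ 2 * ‖v‖ ^ 2 + (inner ℝ u v - t * ‖v‖ ^ 2) ^ 2 := by
  have h := sq_sinAngle_mul u v
  have h2 : ‖u - t • v‖ ^ 2 = ‖u‖ ^ 2 - 2 * (t * inner ℝ u v) + t ^ 2 * ‖v‖ ^ 2 := by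
    rw [norm_sub_sq_real, inner_smul_right, norm_smul, mul_pow, Real.norm_eq_abs, sq_abs]
  rw [h2]
  linear_combination -h

theorem sinAngle_mul_norm_le (u v : E3) (t : ℝ) : sinAngle u v * ‖u‖ ≤ ‖u - t • v‖ := by
  rcases eq_or_ne v 0 with rfl | hv
  · simp
  · have h := sq_norm_sub_smul_mul u v t
    have hv' : 0 < ‖v‖ ^ 2 := by positivity
    refine le_of_sq_le_sq ?_ (norm_nonneg _)
    nlinarith [sq_nonneg (inner ℝ u v - t * ‖v‖ ^ 2)]

theorem exists_norm_sub_smul_eq (u : E3) {v : E3} (hv : v ≠ 0) :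
    ∃ t : ℝ, ‖u - t • v‖ = sinAngle u v * ‖u‖ := by
  refine ⟨inner ℝ u v / ‖v‖ ^ 2, ?_⟩
  have h := sq_norm_sub_smul_mul u v (inner ℝ u v / ‖v‖ ^ 2)
  have hv' : ‖v‖ ^ 2 ≠ 0 := by positivity
  rw [div_mul_cancel₀ _ hv', sub_self] at h
  have h2 : ‖u - (inner ℝ u v / ‖v‖ ^ 2) • v‖ ^ 2 = (sinAngle u v * ‖u‖) ^ 2 := by
    apply mul_right_cancel₀ hv'
    linarith
  exact (sq_eq_sq₀ (norm_nonneg _) (mul_nonneg (sinAngle_nonneg _ _) (norm_nonneg _))).1 h2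

/-- Project `u` to the line of `v` and the result to the line of `w`. The first projection does not
lengthen `u`, so the second error is at most `sinAngle v w * ‖u‖`. -/
theorem sinAngle_triangle (u v w : E3) : sinAngle u w ≤ sinAngle u v + sinAngle v w := by
  rcases eq_or_ne v 0 with rfl | hv
  · simpa using (sinAngle_le_one u w).trans (by norm_num)
  rcases eq_or_ne w 0 with rfl | hw
  · simpa using sinAngle_nonneg u v
  rcases eq_or_ne u 0 with rfl | hu
  · simpa using sinAngle_nonneg v w
  obtain ⟨t, ht⟩ := exists_norm_sub_smul_eq u hv
  obtain ⟨t', ht'⟩ := exists_norm_sub_smul_eq v hw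
  have hu' : 0 < ‖u‖ := norm_pos_iff.2 hu
  have hv' : 0 < ‖v‖ := norm_pos_iff.2 hv
  -- the projection of `u` to the line of `v` is at most as long as `u`
  have hproj : |t| * ‖v‖ ≤ ‖u‖ := by
    have h1 := sq_norm_sub_smul_mul u v t
    rw [ht] at h1
    have h2 : inner ℝ u v = t * ‖v‖ ^ 2 := by
      have : (inner ℝ u v - t * ‖v‖ ^ 2) ^ 2 = 0 := by linarith
      have := pow_eq_zero_iff (two_ne_zero) |>.1 this
      linarith
    have h3 := abs_real_inner_le_norm u v
    rw [h2, abs_mul, abs_of_nonneg (sq_nonneg ‖v‖)] at h3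
    nlinarith
  have h := sinAngle_mul_norm_le u w (t * t')
  have h3 : ‖u - (t * t') • w‖ ≤ ‖u - t • v‖ + |t| * ‖v - t' • w‖ := by
    rw [← Real.norm_eq_abs, ← norm_smul]
    refine le_trans (le_of_eq ?_) (norm_add_le _ _)
    congr 1
    rw [smul_sub, smul_smul]; abel
  rw [ht, ht'] at h3
  have h4 : |t| * (sinAngle v w * ‖v‖) ≤ sinAngle v w * ‖u‖ := by
    nlinarith [sinAngle_nonneg v w]
  have : sinAngle u w * ‖u‖ ≤ (sinAngle u v + sinAngle v w) * ‖u‖ := by linarith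
  exact le_of_mul_le_mul_right this hu'

theorem sinAngle_mul_norm_le_sub (u v : E3) : sinAngle u v * ‖u‖ ≤ ‖u - v‖ := by
  simpa using sinAngle_mul_norm_le u v 1

/-- Law of sines for two sides of a triangle. -/
theorem sinAngle_mul_norm_eq (x y z : E3) (hxy : x ≠ y) :
    sinAngle (y - x) (z - x) * ‖z - x‖ = sinAngle (x - y) (z - y) * ‖z - y‖ := by
  have key : ∀ x y z : E3, x ≠ y →
      sinAngle (y - x) (z - x) * ‖z - x‖ ≤ sinAngle (x - y) (z - y) * ‖z - y‖ := by
    intro x y z hxy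
    obtain ⟨t, ht⟩ := exists_norm_sub_smul_eq (z - y) (sub_ne_zero.2 hxy)
    rw [sinAngle_comm (x - y), ← ht, sinAngle_comm]
    refine (sinAngle_mul_norm_le (z - x) (y - x) (1 - t)).trans (le_of_eq ?_)
    congr 1
    module
  exact le_antisymm (key x y z hxy) (key y x z hxy.symm)

/-- A set is flat up to scale `r`, with tolerance `ε`, if the chords of length at most `r` that
start at a common point span lines at angles at most `arcsin ε`. -/
def IsFlat (K : Set E3) (r ε : ℝ) : Prop :=
  ∀ x ∈ K, ∀ y ∈ K, ∀ z ∈ K, y ≠ x → z ≠ x → ‖y - x‖ ≤ r → ‖z - x‖ ≤ r →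
    sinAngle (y - x) (z - x) ≤ ε

/-! ### Unit loops as periodic arclength parametrizations -/

/-- Pair `γ` with its own chord `v`: the scalar function is absolutely continuous with derivative at
most `‖v‖`, so `‖v‖ ^ 2 ≤ ‖v‖ (t - s)`. -/
theorem IsUnitLoop.lipschitzOnWith_one {γ : ℝ → E3} (hγ : IsUnitLoop γ) :
    LipschitzOnWith 1 γ (Icc 0 1) := by
  obtain ⟨L, hL⟩ := hγ.lipschitz
  have key : ∀ s ∈ Icc (0 : ℝ) 1, ∀ t ∈ Icc (0 : ℝ) 1, s ≤ t → ‖γ t - γ s‖ ≤ t - s := by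
    intro s hs t ht hst
    rcases eq_or_ne (γ t - γ s) 0 with h0 | h0
    · rw [h0]; simpa using hst
    set v : E3 := γ t - γ s with hv
    have hsub : uIcc s t ⊆ Icc 0 1 := by
      rw [uIcc_of_le hst]; exact Icc_subset_Icc hs.1 ht.2
    have hlip : LipschitzOnWith (‖innerSL ℝ v‖₊ * L) (fun τ => inner ℝ v (γ τ)) (uIcc s t) :=
      (innerSL ℝ v).lipschitz.comp_lipschitzOnWith (hL.mono hsub)
    have hac := hlip.absolutelyContinuousOnInterval
    have hint := hac.integral_deriv_eq_sub
    have hdiff : ∀ᵐ τ : ℝ, τ ∈ Ioc s t → ‖deriv (fun τ => inner ℝ v (γ τ)) τ‖ ≤ ‖v‖ := by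
      have h1 := (ae_restrict_iff' measurableSet_Icc).1 hγ.unitSpeed
      filter_upwards [h1] with τ hτ hmem
      have hτ' : ‖deriv γ τ‖ = 1 := hτ ⟨hs.1.trans hmem.1.le, hmem.2.trans ht.2⟩
      have hd : DifferentiableAt ℝ γ τ := by
        by_contra h
        rw [deriv_zero_of_not_differentiableAt h] at hτ'
        simp at hτ'
      have hd2 : HasDerivAt (fun τ => inner ℝ v (γ τ)) (inner ℝ v (deriv γ τ)) τ := by
        simpa using (hasDerivAt_const τ v).inner ℝ hd.hasDerivAt
      rw [hd2.deriv]
      calc ‖inner ℝ v (deriv γ τ)‖ ≤ ‖v‖ * ‖deriv γ τ‖ := norm_inner_le_norm _ _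
        _ = ‖v‖ := by rw [hτ', mul_one]
    have hle := intervalIntegral.norm_integral_le_of_norm_le_const_ae (a := s) (b := t)
      (C := ‖v‖) (f := deriv fun τ => inner ℝ v (γ τ)) (by rwa [uIoc_of_le hst])
    rw [hint, ← inner_sub_right, ← hv, real_inner_self_eq_norm_sq, abs_of_nonneg (sub_nonneg.2 hst),
      Real.norm_of_nonneg (sq_nonneg _)] at hle
    have hvpos : 0 < ‖v‖ := norm_pos_iff.2 h0
    nlinarith
  refine LipschitzOnWith.of_dist_le_mul fun s hs t ht => ?_
  simp only [NNReal.coe_one, one_mul]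
  rcases le_total s t with hst | hst
  · rw [dist_comm, dist_eq_norm, dist_comm, Real.dist_eq, abs_of_nonneg (sub_nonneg.2 hst)]
    exact key s hs t ht hst
  · rw [dist_eq_norm, Real.dist_eq, abs_of_nonneg (sub_nonneg.2 hst)]
    exact key t ht s hs hst

/-- The 1-periodic extension of a closed curve. -/
noncomputable def periodize (γ : ℝ → E3) : ℝ → E3 := fun t => γ (Int.fract t)

/-- The properties of the periodic extension of a simple unit loop. -/
structure IsArcLoop (Γ : ℝ → E3) : Prop where
  lipschitz : LipschitzWith 1 Γ
  periodic : Function.Periodic Γ 1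
  inj : ∀ s t, Γ s = Γ t → ∃ n : ℤ, s - t = n
  length : ∀ s t, s ≤ t → t ≤ s + 1 → ENNReal.ofReal (t - s) ≤ μH[1] (Γ '' Icc s t)

theorem range_periodize {γ : ℝ → E3} (h : γ 0 = γ 1) : range (periodize γ) = trace γ := by
  ext x
  constructor
  · rintro ⟨t, rfl⟩
    exact ⟨Int.fract t, ⟨Int.fract_nonneg t, (Int.fract_lt_one t).le⟩, rfl⟩
  · rintro ⟨t, ⟨h0, h1⟩, rfl⟩
    rcases eq_or_lt_of_le h1 with rfl | h1
    · exact ⟨0, by simp [periodize, h]⟩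
    · exact ⟨t, by simp [periodize, Int.fract_eq_self.2 ⟨h0, h1⟩]⟩

theorem LipschitzWith.hausdorffMeasure_one_image_Icc_le {Γ : ℝ → E3} (h : LipschitzWith 1 Γ)
    (s t : ℝ) : μH[1] (Γ '' Icc s t) ≤ ENNReal.ofReal (t - s) := by
  simpa [hausdorffMeasure_real] using h.hausdorffMeasure_image_le zero_le_one (Icc s t)

theorem IsUnitLoop.isArcLoop {γ : ℝ → E3} (hγ : IsUnitLoop γ) (hs : IsSimpleClosed γ) :
    IsArcLoop (periodize γ) := by
  have hlip := hγ.lipschitzOnWith_one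
  have hper : Function.Periodic (periodize γ) 1 := fun t => by simp [periodize]
  have hL : LipschitzWith 1 (periodize γ) := by
    have key : ∀ s t, s ≤ t → dist (periodize γ s) (periodize γ t) ≤ t - s := by
      intro s t hst
      have hm : ∀ u : ℝ, Int.fract u ∈ Icc (0 : ℝ) 1 := fun u =>
        ⟨Int.fract_nonneg u, (Int.fract_lt_one u).le⟩
      have hfl := Int.floor_mono hst
      have e1 := Int.floor_add_fract s
      have e2 := Int.floor_add_fract t
      rcases eq_or_lt_of_le hfl with h | h
      · have := hlip.dist_le_mul _ (hm s) _ (hm t)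
        refine this.trans ?_
        rw [Real.dist_eq, NNReal.coe_one, one_mul]
        have : Int.fract s - Int.fract t = s - t := by
          rw [h] at e1; linarith
        rw [this, abs_sub_comm, abs_of_nonneg (sub_nonneg.2 hst)]
      · have h1 := hlip.dist_le_mul _ (hm s) 1 (by simp)
        have h2 := hlip.dist_le_mul 0 (by simp) _ (hm t)
        have h3 := dist_triangle (γ (Int.fract s)) (γ 1) (γ (Int.fract t))
        rw [← hγ.closed] at h3 h1
        rw [Real.dist_eq, abs_sub_comm, abs_of_nonneg (sub_nonneg.2 (hm s).2)] at h1
        rw [Real.dist_eq, abs_sub_comm, abs_of_nonneg (sub_nonneg.2 (hm t).1)] at h2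
        have h4 : (⌊s⌋ : ℝ) + 1 ≤ ⌊t⌋ := by exact_mod_cast h
        simp only [NNReal.coe_one, one_mul] at h1 h2
        simp only [periodize]
        linarith
    refine LipschitzWith.of_dist_le_mul fun s t => ?_
    rw [NNReal.coe_one, one_mul, Real.dist_eq]
    rcases le_total s t with h | h
    · rw [abs_sub_comm, abs_of_nonneg (sub_nonneg.2 h)]; exact key s t h
    · rw [dist_comm, abs_of_nonneg (sub_nonneg.2 h)]; exact key t s h
  refine ⟨hL, hper, fun s t h => ?_, fun s t h1 h2 => ?_⟩
  · have := hs.injOn ⟨Int.fract_nonneg s, Int.fract_lt_one s⟩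
      ⟨Int.fract_nonneg t, Int.fract_lt_one t⟩ h
    exact Int.fract_eq_fract.1 this
  -- The trace has measure one and the complementary arc has measure at most `s + 1 - t`, which
  -- leaves at least `t - s`.
  · have hcov : trace γ ⊆ periodize γ '' Icc s t ∪ periodize γ '' Icc t (s + 1) := by
      rw [← range_periodize hγ.closed, ← image_union, Icc_union_Icc_eq_Icc h1 h2]
      rintro _ ⟨u, rfl⟩
      obtain ⟨y, hy, hy'⟩ := hper.exists_mem_Ico (by norm_num) u s
      exact ⟨y, ⟨hy.1, hy.2.le⟩, hy'.symm⟩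
    have h3 := (measure_mono hcov).trans (measure_union_le (μ := (μH[1] : Measure E3)) _ _)
    rw [hγ.hausdorff] at h3
    have h4 := LipschitzWith.hausdorffMeasure_one_image_Icc_le hL t (s + 1)
    have h5 : (1 : ℝ≥0∞) = ENNReal.ofReal (t - s) + ENNReal.ofReal (s + 1 - t) := by
      rw [← ENNReal.ofReal_add (by linarith) (by linarith), ← ENNReal.ofReal_one]
      congr 1; ring
    have h6 := h3.trans (add_le_add_right h4 _)
    rw [h5] at h6
    exact (ENNReal.add_le_add_iff_right ENNReal.ofReal_ne_top).1 h6

namespace IsArcLoop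

variable {Γ : ℝ → E3}

theorem norm_map_sub_le (h : IsArcLoop Γ) (s t : ℝ) : ‖Γ s - Γ t‖ ≤ |s - t| := by
  simpa [dist_eq_norm, Real.dist_eq] using h.lipschitz.dist_le_mul s t

theorem add_int (h : IsArcLoop Γ) (s : ℝ) (n : ℤ) : Γ (s + n) = Γ s := by
  simpa using h.periodic.int_mul n s

theorem eq_of_abs_sub_lt (h : IsArcLoop Γ) {s t : ℝ} (hst : |s - t| < 1) (he : Γ s = Γ t) :
    s = t := by
  obtain ⟨n, hn⟩ := h.inj s t he
  rw [hn] at hst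
  have h1 : |n| < 1 := by exact_mod_cast hst
  rw [Int.abs_lt_one_iff.1 h1] at hn
  simpa [sub_eq_zero] using hn

/-- On short intervals a flat arc loop is nearly a straight segment, and all nearby points of the
loop see the points of the segment in nearly the same direction. -/
theorem exists_direction (h : IsArcLoop Γ) {r : ℝ} (hr1 : r ≤ 1 / 4)
    (hf : IsFlat (range Γ) r (1 / 1000)) {a b : ℝ} (hab : a < b) (hbr : b - a ≤ r) :
    ∃ v : E3, ‖v‖ = 1 ∧
      (∀ s ∈ Icc a b, ∀ y ∈ range Γ, y ≠ Γ s → ‖y - Γ s‖ ≤ r → sinAngle (y - Γ s) v ≤ 1 / 500) ∧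
      (∀ s ∈ Icc a b, ∀ t ∈ Icc a b, s < t → inner ℝ v (Γ s) < inner ℝ v (Γ t)) ∧
      (∀ s ∈ Icc a b, ∀ t ∈ Icc a b, s ≤ t → ‖Γ t - Γ s - (t - s) • v‖ ≤ (t - s) / 250) := by
  have hne : ∀ s ∈ Icc a b, ∀ t ∈ Icc a b, s ≠ t → Γ s ≠ Γ t := by
    intro s hs t ht hst he
    refine hst (h.eq_of_abs_sub_lt ?_ he)
    rw [abs_lt]; constructor <;> linarith [hs.1, hs.2, ht.1, ht.2]
  have hdist : ∀ s ∈ Icc a b, ∀ t ∈ Icc a b, ‖Γ s - Γ t‖ ≤ r := by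
    intro s hs t ht
    refine (h.norm_map_sub_le s t).trans ?_
    rw [abs_le]; constructor <;> linarith [hs.1, hs.2, ht.1, ht.2]
  have ha : a ∈ Icc a b := ⟨le_rfl, hab.le⟩
  have hb : b ∈ Icc a b := ⟨hab.le, le_rfl⟩
  have hba : 0 < ‖Γ b - Γ a‖ := norm_pos_iff.2 (sub_ne_zero.2 (hne b hb a ha hab.ne'))
  set v : E3 := ‖Γ b - Γ a‖⁻¹ • (Γ b - Γ a) with hv
  have hv1 : ‖v‖ = 1 := by
    rw [hv, norm_smul, norm_inv, norm_norm, inv_mul_cancel₀ hba.ne']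
  have hsin : ∀ u, sinAngle u v = sinAngle u (Γ b - Γ a) := fun u =>
    sinAngle_smul_right (inv_pos.2 hba) _ _
  have hdir : ∀ s ∈ Icc a b, ∀ y ∈ range Γ, y ≠ Γ s → ‖y - Γ s‖ ≤ r →
      sinAngle (y - Γ s) v ≤ 1 / 500 := by
    intro s hs y hy hys hyr
    rw [hsin]
    rcases eq_or_ne s a with rfl | hsa
    · exact (hf _ ⟨s, rfl⟩ y hy _ ⟨b, rfl⟩ hys (hne b hb s ha hab.ne') hyr
        (hdist b hb s ha)).trans (by norm_num)
    -- Flatness is used at `Γ s` and at `Γ a`, both times with the chord joining them; two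
    -- tolerances `1 / 1000` add up.
    · have h1 := hf _ ⟨s, rfl⟩ y hy _ ⟨a, rfl⟩ hys (hne a ha s hs hsa.symm) hyr (hdist a ha s hs)
      have h2 := hf _ ⟨a, rfl⟩ _ ⟨s, rfl⟩ _ ⟨b, rfl⟩ (hne s hs a ha hsa) (hne b hb a ha hab.ne')
        (hdist s hs a ha) (hdist b hb a ha)
      have h3 := sinAngle_triangle (y - Γ s) (Γ a - Γ s) (Γ b - Γ a)
      rw [sinAngle_sub_comm (Γ a)] at h3
      linarith
  -- A chord between points of equal height would be orthogonal to `v`, with sine `1`.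
  have hinj : InjOn (fun s => inner ℝ v (Γ s)) (Icc a b) := by
    intro s hs t ht hst
    by_contra hne'
    have h1 := hdir s hs (Γ t) ⟨t, rfl⟩ (hne t ht s hs (Ne.symm hne')) (hdist t ht s hs)
    rw [sinAngle_eq_one_of_inner_eq_zero] at h1
    · norm_num at h1
    · rw [real_inner_comm, inner_sub_right, sub_eq_zero]; exact hst.symm
  have hmono : StrictMonoOn (fun s => inner ℝ v (Γ s)) (Icc a b) := by
    refine ContinuousOn.strictMonoOn_of_injOn_Icc hab.le ?_ ?_ hinj
    · have : inner ℝ v (Γ b - Γ a) = ‖Γ b - Γ a‖ := by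
        rw [hv, inner_smul_left, real_inner_self_eq_norm_sq]
        simp only [map_inv₀, conj_trivial]
        field_simp
      rw [inner_sub_right] at this
      show inner ℝ v (Γ a) ≤ inner ℝ v (Γ b)
      linarith
    · have := h.lipschitz.continuous
      fun_prop
  -- the part of a chord orthogonal to `v`
  have hperp : ∀ s ∈ Icc a b, ∀ t ∈ Icc a b, s ≤ t →
      ‖Γ t - Γ s - inner ℝ v (Γ t - Γ s) • v‖ ≤ ‖Γ t - Γ s‖ / 500 := by
    intro s hs t ht hst
    rcases eq_or_ne s t with rfl | hne'
    · simp
    have h1 := hdir s hs (Γ t) ⟨t, rfl⟩ (hne t ht s hs hne'.symm) (hdist t ht s hs)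
    have h2 := sq_norm_sub_smul_mul (Γ t - Γ s) v (inner ℝ v (Γ t - Γ s))
    rw [hv1, real_inner_comm v (Γ t - Γ s)] at h2
    simp only [one_pow, mul_one, sub_self, ne_eq, OfNat.ofNat_ne_zero, not_false_eq_true,
      zero_pow, add_zero] at h2
    have h3 := (sq_eq_sq₀ (norm_nonneg _)
      (mul_nonneg (sinAngle_nonneg _ _) (norm_nonneg _))).1 h2
    rw [h3]
    nlinarith [norm_nonneg (Γ t - Γ s)]
  have hchord : ∀ s ∈ Icc a b, ∀ t ∈ Icc a b, s ≤ t →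
      ‖Γ t - Γ s‖ ≤ 500 / 499 * inner ℝ v (Γ t - Γ s) := by
    intro s hs t ht hst
    have h1 := hperp s hs t ht hst
    have h2 : ‖Γ t - Γ s‖ ≤ ‖Γ t - Γ s - inner ℝ v (Γ t - Γ s) • v‖ +
        ‖inner ℝ v (Γ t - Γ s) • v‖ := by
      simpa using norm_add_le (Γ t - Γ s - inner ℝ v (Γ t - Γ s) • v)
        (inner ℝ v (Γ t - Γ s) • v)
    have h3 : 0 ≤ inner ℝ v (Γ t - Γ s) := by
      rw [inner_sub_right, sub_nonneg]
      exact hmono.monotoneOn hs ht hst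
    rw [norm_smul, hv1, mul_one, Real.norm_of_nonneg h3] at h2
    linarith
  -- The arc is a `500 / 499`-Lipschitz image of its interval of heights, so its Hausdorff measure,
  -- which is at least `t - s`, is at most `500 / 499` times the gain in height.
  have hlen : ∀ s ∈ Icc a b, ∀ t ∈ Icc a b, s ≤ t →
      t - s ≤ 500 / 499 * inner ℝ v (Γ t - Γ s) := by
    intro s hs t ht hst
    have hsub : Icc s t ⊆ Icc a b := Icc_subset_Icc hs.1 ht.2
    set g : ℝ → ℝ := fun s => inner ℝ v (Γ s) with hg
    have hginj : InjOn g (Icc s t) := hinj.mono hsub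
    have hL : LipschitzOnWith (500 / 499) (fun q => Γ (Function.invFunOn g (Icc s t) q))
        (g '' Icc s t) := by
      refine LipschitzOnWith.of_dist_le_mul ?_
      rintro _ ⟨p, hp, rfl⟩ _ ⟨q, hq, rfl⟩
      rw [hginj.leftInvOn_invFunOn hp, hginj.leftInvOn_invFunOn hq]
      have hgen : ∀ p ∈ Icc s t, ∀ q ∈ Icc s t, p ≤ q → dist (Γ p) (Γ q) ≤
          500 / 499 * dist (g p) (g q) := by
        intro p hp q hq hpq
        have := hchord p (hsub hp) q (hsub hq) hpq
        rw [dist_comm, dist_eq_norm, dist_comm, Real.dist_eq]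
        refine this.trans ?_
        rw [inner_sub_right]
        gcongr
        exact le_abs_self _
      have hc : (((500 / 499 : ℝ≥0)) : ℝ) = 500 / 499 := by norm_num
      rw [hc]
      rcases le_total p q with hpq | hpq
      · exact hgen p hp q hq hpq
      · rw [dist_comm, dist_comm (g p)]; exact hgen q hq p hp hpq
    have him : (fun q => Γ (Function.invFunOn g (Icc s t) q)) '' (g '' Icc s t) = Γ '' Icc s t := by
      rw [image_image]
      exact image_congr fun p hp => by rw [hginj.leftInvOn_invFunOn hp]
    have h1 := hL.hausdorffMeasure_image_le zero_le_one
    rw [him, hausdorffMeasure_real, ENNReal.rpow_one] at h1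
    have h2 : volume (g '' Icc s t) ≤ ENNReal.ofReal (g t - g s) := by
      rw [← Real.volume_Icc]
      refine measure_mono ?_
      rintro _ ⟨p, hp, rfl⟩
      exact ⟨hmono.monotoneOn hs (hsub hp) hp.1, hmono.monotoneOn (hsub hp) ht hp.2⟩
    have h3 := h.length s t hst (by linarith [hs.1, ht.2])
    have hgst : 0 ≤ g t - g s := sub_nonneg.2 (hmono.monotoneOn hs ht hst)
    have h4 : ENNReal.ofReal (t - s) ≤ ENNReal.ofReal (500 / 499 * (g t - g s)) := by
      refine h3.trans (h1.trans ?_)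
      rw [ENNReal.ofReal_mul (by norm_num)]
      refine mul_le_mul' (le_of_eq ?_) h2
      rw [← ENNReal.ofReal_coe_nnreal]
      norm_num
    rw [inner_sub_right]
    exact (ENNReal.ofReal_le_ofReal_iff (by positivity)).1 h4
  refine ⟨v, hv1, hdir, fun s hs t ht hst => hmono hs ht hst, fun s hs t ht hst => ?_⟩
  have h1 := hperp s hs t ht hst
  have h2 := hlen s hs t ht hst
  have h3 : ‖Γ t - Γ s‖ ≤ t - s := by
    simpa [abs_of_nonneg (sub_nonneg.2 hst)] using h.norm_map_sub_le t s
  have h4 : inner ℝ v (Γ t - Γ s) ≤ ‖Γ t - Γ s‖ := by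
    simpa [hv1] using real_inner_le_norm v (Γ t - Γ s)
  -- The orthogonal part and the defect in height contribute `(t - s) / 500` each.
  have h5 : ‖Γ t - Γ s - (t - s) • v‖ ≤ ‖Γ t - Γ s - inner ℝ v (Γ t - Γ s) • v‖ +
      ‖(inner ℝ v (Γ t - Γ s) - (t - s)) • v‖ := by
    refine le_trans (le_of_eq ?_) (norm_add_le _ _)
    congr 1; module
  rw [norm_smul, hv1, mul_one, Real.norm_eq_abs, abs_of_nonpos (by linarith)] at h5
  linarith

end IsArcLoop

/-! ### Nearby flat loops are ambient isotopic -/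

namespace IsArcLoop

variable {Γ : ℝ → E3}

/-- Points of a flat arc loop that are close in space are close along the loop. -/
theorem exists_int_abs_sub_le (h : IsArcLoop Γ) {r : ℝ} (hr0 : 0 < r) (hr1 : r ≤ 1 / 4)
    (hf : IsFlat (range Γ) r (1 / 1000)) {s t : ℝ} (hst : ‖Γ s - Γ t‖ ≤ r / 4) :
    ∃ n : ℤ, |s - t - n| ≤ 2 * ‖Γ s - Γ t‖ := by
  obtain ⟨v, hv1, hdir, -, hlin⟩ := h.exists_direction hr1 hf (a := s - r / 2) (b := s + r / 2)
    (by linarith) (by linarith)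
  have hs : s ∈ Icc (s - r / 2) (s + r / 2) := ⟨by linarith, by linarith⟩
  have hv2 : inner ℝ v v = (1 : ℝ) := by rw [real_inner_self_eq_norm_sq, hv1, one_pow]
  have hgrow : ∀ p ∈ Icc (s - r / 2) (s + r / 2), ∀ q ∈ Icc (s - r / 2) (s + r / 2), p ≤ q →
      249 / 250 * (q - p) ≤ inner ℝ v (Γ q) - inner ℝ v (Γ p) := by
    intro p hp q hq hpq
    have h1 := hlin p hp q hq hpq
    have h2 := abs_le.1 (abs_real_inner_le_norm v (Γ q - Γ p - (q - p) • v))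
    rw [hv1, one_mul, inner_sub_right, inner_sub_right, inner_smul_right, hv2] at h2
    linarith [h2.1]
  have hd := abs_le.1 (abs_real_inner_le_norm v (Γ s - Γ t))
  rw [hv1, one_mul, inner_sub_right] at hd
  have ha := hgrow (s - r / 2) ⟨le_rfl, by linarith⟩ s hs (by linarith)
  have hb := hgrow s hs (s + r / 2) ⟨by linarith, le_rfl⟩ (by linarith)
  have hcont : ContinuousOn (fun p => inner ℝ v (Γ p)) (Icc (s - r / 2) (s + r / 2)) := by
    have := h.lipschitz.continuous
    fun_prop
  -- The arc around `s` reaches the height of `Γ t` at some `p`; since a chord orthogonal to `v` is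
  -- impossible at this scale, `Γ p = Γ t`.
  obtain ⟨p, hp, hpt⟩ := intermediate_value_Icc (by linarith) hcont
    (show inner ℝ v (Γ t) ∈ Icc _ _ from ⟨by linarith [hd.1], by linarith [hd.2]⟩)
  simp only at hpt
  have hps : |s - p| ≤ 2 * ‖Γ s - Γ t‖ := by
    rcases le_total p s with hle | hle
    · have := hgrow p hp s hs hle
      rw [abs_of_nonneg (by linarith)]
      linarith [hd.2]
    · have := hgrow s hs p hp hle
      rw [abs_of_nonpos (by linarith)]
      linarith [hd.1]
  have hpe : Γ t = Γ p := by
    by_contra hne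
    have h1 : ‖Γ t - Γ p‖ ≤ r := by
      have e1 := norm_sub_le_norm_sub_add_norm_sub (Γ t) (Γ s) (Γ p)
      have e2 := h.norm_map_sub_le s p
      rw [norm_sub_rev (Γ t) (Γ s)] at e1
      linarith
    have h2 := hdir p hp (Γ t) ⟨t, rfl⟩ hne h1
    rw [sinAngle_eq_one_of_inner_eq_zero] at h2
    · norm_num at h2
    · rw [real_inner_comm, inner_sub_right, hpt, sub_self]
  obtain ⟨n, hn⟩ := h.inj t p hpe
  refine ⟨-n, ?_⟩
  push_cast
  rw [← hn]
  convert! hps using 2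
  ring

/-- If two flat arc loops are close at the points of a fine grid, then their difference is
Lipschitz, with a small constant, with respect to the distance in space. -/
theorem norm_sub_sub_sub_le {Γ' : ℝ → E3} (h : IsArcLoop Γ) (h' : IsArcLoop Γ') {r : ℝ}
    (hr0 : 0 < r) (hr1 : r ≤ 1 / 4) (hf : IsFlat (range Γ) r (1 / 1000))
    (hf' : IsFlat (range Γ') r (1 / 1000)) {δ : ℝ} (hδ : 0 < δ) (hδr : 2 * δ ≤ r)
    (hgrid : ∀ k : ℤ, ‖Γ' (k * δ) - Γ (k * δ)‖ ≤ δ / 250) (s t : ℝ) :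
    ‖(Γ' s - Γ s) - (Γ' t - Γ t)‖ ≤ ‖Γ s - Γ t‖ / 10 := by
  -- the difference on a cell of the grid
  have hcell : ∀ k : ℤ, ∀ p ∈ Icc (k * δ) (k * δ + 2 * δ), ∀ q ∈ Icc (k * δ) (k * δ + 2 * δ),
      ‖(Γ' p - Γ p) - (Γ' q - Γ q)‖ ≤ |p - q| / 50 := by
    intro k
    obtain ⟨v, -, -, -, hl⟩ := h.exists_direction hr1 hf (a := k * δ) (b := k * δ + 2 * δ)
      (by linarith) (by linarith)
    obtain ⟨v', -, -, -, hl'⟩ := h'.exists_direction hr1 hf' (a := k * δ) (b := k * δ + 2 * δ)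
      (by linarith) (by linarith)
    -- Two linearization errors `2 * δ / 250` and two grid errors `δ / 250`, divided by the cell
    -- length `2 * δ`.
    have hvv : ‖v' - v‖ ≤ 3 / 250 := by
      have ha : k * δ ∈ Icc (k * δ) (k * δ + 2 * δ) := ⟨le_rfl, by linarith⟩
      have hb : k * δ + 2 * δ ∈ Icc (k * δ) (k * δ + 2 * δ) := ⟨by linarith, le_rfl⟩
      have e1 := hl _ ha _ hb (by linarith)
      have e2 := hl' _ ha _ hb (by linarith)
      have e3 := hgrid k
      have e4 := hgrid (k + 2)
      have e5 : ((k + 2 : ℤ) : ℝ) * δ = k * δ + 2 * δ := by push_cast; ring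
      rw [e5] at e4
      have e6 : (2 * δ) • (v' - v) =
          (Γ (k * δ + 2 * δ) - Γ (k * δ) - (k * δ + 2 * δ - k * δ) • v) -
          (Γ' (k * δ + 2 * δ) - Γ' (k * δ) - (k * δ + 2 * δ - k * δ) • v') +
          (Γ' (k * δ + 2 * δ) - Γ (k * δ + 2 * δ)) - (Γ' (k * δ) - Γ (k * δ)) := by module
      have e7 : ‖(2 * δ) • (v' - v)‖ ≤ 2 * δ / 250 + 2 * δ / 250 + δ / 250 + δ / 250 := by
        rw [e6]
        refine (norm_sub_le _ _).trans (add_le_add ?_ e3)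
        refine (norm_add_le _ _).trans (add_le_add ?_ e4)
        refine (norm_sub_le _ _).trans ?_
        linarith
      rw [norm_smul, Real.norm_of_nonneg (by linarith)] at e7
      nlinarith
    have key : ∀ p ∈ Icc (k * δ) (k * δ + 2 * δ), ∀ q ∈ Icc (k * δ) (k * δ + 2 * δ), q ≤ p →
        ‖(Γ' p - Γ p) - (Γ' q - Γ q)‖ ≤ (p - q) / 50 := by
      intro p hp q hq hqp
      have e1 := hl _ hq _ hp hqp
      have e2 := hl' _ hq _ hp hqp
      have e3 : (Γ' p - Γ p) - (Γ' q - Γ q) = (Γ' p - Γ' q - (p - q) • v') -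
          (Γ p - Γ q - (p - q) • v) + (p - q) • (v' - v) := by module
      rw [e3]
      refine (norm_add_le _ _).trans ?_
      rw [norm_smul, Real.norm_of_nonneg (sub_nonneg.2 hqp)]
      have e4 := norm_sub_le (Γ' p - Γ' q - (p - q) • v') (Γ p - Γ q - (p - q) • v)
      nlinarith
    intro p hp q hq
    rcases le_total q p with hqp | hqp
    · rw [abs_of_nonneg (sub_nonneg.2 hqp)]; exact key p hp q hq hqp
    · rw [norm_sub_rev, abs_sub_comm, abs_of_nonneg (sub_nonneg.2 hqp)]; exact key q hq p hp hqp
  have hfloor : ∀ p : ℝ, ⌊p / δ⌋ * δ ≤ p ∧ p < ⌊p / δ⌋ * δ + δ := by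
    intro p
    have e1 := Int.floor_le (p / δ)
    have e2 := Int.lt_floor_add_one (p / δ)
    rw [le_div_iff₀ hδ] at e1
    rw [div_lt_iff₀ hδ] at e2
    exact ⟨e1, by linarith⟩
  have hsmall : ∀ p, ‖Γ' p - Γ p‖ ≤ 6 * δ / 250 := by
    intro p
    obtain ⟨e1, e2⟩ := hfloor p
    have e3 := hcell ⌊p / δ⌋ p ⟨e1, by linarith⟩ _ ⟨le_rfl, by linarith⟩
    rw [abs_of_nonneg (by linarith)] at e3
    have e4 := hgrid ⌊p / δ⌋
    have e5 := norm_le_norm_add_norm_sub' (Γ' p - Γ p)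
      (Γ' (⌊p / δ⌋ * δ) - Γ (⌊p / δ⌋ * δ))
    linarith
  -- For close points the parameters differ, up to an integer, by at most `2 * ‖Γ s - Γ t‖ ≤ δ`; the
  -- cells have length `2 * δ` and overlap, so one cell contains both. For distant points the size
  -- of the differences suffices: `12 * δ / 250 ≤ δ / 20`.
  rcases le_total ‖Γ s - Γ t‖ (δ / 2) with hd | hd
  · obtain ⟨n, hn⟩ := h.exists_int_abs_sub_le hr0 hr1 hf (s := s) (t := t) (by linarith)
    have e1 : ∀ p q : ℝ, p ≤ q → q ≤ p + δ →
        ‖(Γ' p - Γ p) - (Γ' q - Γ q)‖ ≤ |p - q| / 50 := by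
      intro p q hpq hqp
      obtain ⟨e1, e2⟩ := hfloor p
      exact hcell ⌊p / δ⌋ p ⟨e1, by linarith⟩ q ⟨by linarith, by linarith⟩
    have e2 : ‖(Γ' s - Γ s) - (Γ' (t + n) - Γ (t + n))‖ ≤ |s - (t + n)| / 50 := by
      have e3 : |s - (t + n)| ≤ δ := by
        rw [← sub_sub]; linarith
      rw [abs_le] at e3
      rcases le_total s (t + n) with hle | hle
      · exact e1 _ _ hle (by linarith)
      · rw [norm_sub_rev, abs_sub_comm]; exact e1 _ _ hle (by linarith)
    rw [h.add_int, h'.add_int, ← sub_sub] at e2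
    linarith [norm_nonneg (Γ s - Γ t)]
  · have e1 := hsmall s
    have e2 := hsmall t
    have e3 := norm_sub_le (Γ' s - Γ s) (Γ' t - Γ t)
    linarith

end IsArcLoop

/-! ### Lipschitz perturbations of the identity as ambient isotopies. -/

theorem norm_le_two_mul_of_abs_le {w : E3} {c : ℝ} (h : ∀ i, |w i| ≤ c) : ‖w‖ ≤ 2 * c := by
  have hc : 0 ≤ c := (abs_nonneg _).trans (h 0)
  rw [EuclideanSpace.norm_eq, Real.sqrt_le_left (by positivity), Fin.sum_univ_three]
  have h2 : ∀ i, ‖w i‖ ^ 2 ≤ c ^ 2 := fun i => by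
    rw [Real.norm_eq_abs]; exact pow_le_pow_left₀ (abs_nonneg _) (h i) 2
  nlinarith [h2 0, h2 1, h2 2]

/-- Extension of Lipschitz maps with values in `ℝ³`. -/
theorem LipschitzOnWith.exists_extension {K : Set E3} {f : E3 → E3} {c : ℝ≥0}
    (h : LipschitzOnWith c f K) : ∃ u : E3 → E3, LipschitzWith (2 * c) u ∧ EqOn f u K := by
  have hi : ∀ i : Fin 3, LipschitzOnWith c (fun x => f x i) K := by
    intro i
    refine LipschitzOnWith.of_dist_le_mul fun x hx y hy => ?_
    refine le_trans ?_ (h.dist_le_mul x hx y hy)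
    rw [dist_eq_norm, dist_eq_norm]
    exact PiLp.norm_apply_le (f x - f y) i
  -- Coordinatewise extension loses a factor `√3`, rounded up to `2`.
  choose g hg hfg using fun i => (hi i).extend_real
  refine ⟨fun x => WithLp.toLp 2 fun i => g i x, ?_, fun x hx => ?_⟩
  · refine LipschitzWith.of_dist_le_mul fun x y => ?_
    rw [dist_eq_norm, NNReal.coe_mul, mul_assoc]
    refine norm_le_two_mul_of_abs_le fun i => ?_
    simpa [Real.dist_eq] using (hg i).dist_le_mul x y
  · ext i
    exact hfg i hx

/-- A perturbation of the identity by a contraction moves every set by an ambient isotopy. -/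
theorem ambientIsotopic_image_add {u : E3 → E3} {c : ℝ≥0} (hc : c < 1) (hu : LipschitzWith c u)
    (K : Set E3) : AmbientIsotopic K ((fun x => x + u x) '' K) := by
  have happ : ∀ t : I, ApproximatesLinearOn (fun x => x + (t : ℝ) • u x)
      ((ContinuousLinearEquiv.refl ℝ E3 : E3 ≃L[ℝ] E3) : E3 →L[ℝ] E3) univ c := by
    intro t x _ y _
    have e : x + (t : ℝ) • u x - (y + (t : ℝ) • u y) -
        ((ContinuousLinearEquiv.refl ℝ E3 : E3 ≃L[ℝ] E3) : E3 →L[ℝ] E3) (x - y) =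
        (t : ℝ) • (u x - u y) := by
      simp only [ContinuousLinearEquiv.coe_refl, ContinuousLinearMap.id_apply]
      module
    rw [e, norm_smul, Real.norm_of_nonneg t.2.1]
    have h1 := hu.dist_le_mul x y
    rw [dist_eq_norm, dist_eq_norm] at h1
    nlinarith [t.2.2, t.2.1, norm_nonneg (u x - u y)]
  -- A perturbation of an invertible linear map is a global homeomorphism if its Lipschitz constant
  -- is below the inverse norm of the inverse map, here `1`.
  have hN : Subsingleton E3 ∨
      c < ‖((ContinuousLinearEquiv.refl ℝ E3).symm : E3 →L[ℝ] E3)‖₊⁻¹ := by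
    right
    have : ‖((ContinuousLinearEquiv.refl ℝ E3).symm : E3 →L[ℝ] E3)‖₊ = 1 := by
      ext; simp
    rw [this]; simpa using hc
  refine ⟨fun t => (happ t).toHomeomorph _ hN, ?_, ?_, ?_⟩
  · have := hu.continuous
    show Continuous fun q : I × E3 => q.2 + (q.1 : ℝ) • u q.2
    fun_prop
  · ext1 x
    show x + ((0 : I) : ℝ) • u x = x
    simp
  · show (fun x => x + ((1 : I) : ℝ) • u x) '' K = _
    simp

/-- The hypothesis makes the displacement `Γ' s - Γ s` a function of the point `Γ s` alone, with
Lipschitz constant `1 / 10`. Its extension has constant `1 / 5 < 1`. -/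
theorem ambientIsotopic_range_of_norm_sub_le {Γ Γ' : ℝ → E3}
    (h : ∀ s t, ‖(Γ' s - Γ s) - (Γ' t - Γ t)‖ ≤ ‖Γ s - Γ t‖ / 10) :
    AmbientIsotopic (range Γ) (range Γ') := by
  set f : E3 → E3 := fun x => Γ' (Function.invFun Γ x) - Γ (Function.invFun Γ x) with hf
  have hinv : ∀ s, Γ (Function.invFun Γ (Γ s)) = Γ s := fun s =>
    Function.invFun_eq ⟨s, rfl⟩
  have hfs : ∀ s, f (Γ s) = Γ' s - Γ s := by
    intro s
    have h1 := h (Function.invFun Γ (Γ s)) s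
    rw [hinv, sub_self, norm_zero, zero_div] at h1
    have h2 := sub_eq_zero.1 (norm_le_zero_iff.1 h1)
    show Γ' (Function.invFun Γ (Γ s)) - Γ (Function.invFun Γ (Γ s)) = _
    rw [hinv, h2]
  have hlip : LipschitzOnWith (1 / 10) f (range Γ) := by
    refine LipschitzOnWith.of_dist_le_mul ?_
    rintro _ ⟨s, rfl⟩ _ ⟨t, rfl⟩
    rw [hfs, hfs, dist_eq_norm, dist_eq_norm]
    have := h s t
    have e : (((1 / 10 : ℝ≥0)) : ℝ) = 1 / 10 := by norm_num
    rw [e]; linarith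
  obtain ⟨u, hu, hfu⟩ := LipschitzOnWith.exists_extension hlip
  have e : (fun x => x + u x) '' range Γ = range Γ' := by
    rw [← range_comp]
    congr 1
    ext1 s
    show Γ s + u (Γ s) = Γ' s
    rw [← hfu ⟨s, rfl⟩, hfs]
    abel
  rw [← e]
  refine ambientIsotopic_image_add ?_ hu _
  rw [← NNReal.coe_lt_coe]
  norm_num

/-! ### Finitely many knot types among flat loops -/

/-- For a fixed scale, the simple unit loops that are flat up to that scale represent only finitely
many knot types. -/
theorem finite_knotTypes_of_isFlat {r : ℝ} (hr : 0 < r) :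
    {κ : KnotType | ∃ (γ : ℝ → E3) (hγ : IsSimpleClosed γ),
      IsUnitLoop γ ∧ IsFlat (trace γ) r (1 / 1000) ∧ knotType γ hγ = κ}.Finite := by
  wlog hr1 : r ≤ 1 / 4 generalizing r
  · refine (this (r := 1 / 4) (by norm_num) le_rfl).subset ?_
    rintro κ ⟨γ, hγ, hu, hf, hκ⟩
    refine ⟨γ, hγ, hu, fun x hx y hy z hz hyx hzx h1 h2 => ?_, hκ⟩
    push Not at hr1
    exact hf x hx y hy z hz hyx hzx (h1.trans hr1.le) (h2.trans hr1.le)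
  obtain ⟨N, hN⟩ := exists_nat_gt (2 / r)
  have hNpos : (0 : ℝ) < N := lt_trans (by positivity) hN
  set δ : ℝ := 1 / N with hδ
  have hδpos : 0 < δ := by positivity
  have hδr : 2 * δ ≤ r := by
    rw [div_lt_iff₀ hr] at hN
    rw [hδ, mul_one_div, div_le_iff₀ hNpos]; linarith
  -- the samples of a loop at the grid points
  set S : (ℝ → E3) → (Fin N → E3) := fun γ k => periodize γ (k * δ) with hS
  -- Loops through the origin stay in the unit ball. Two loops with the same net point have samples
  -- within `δ / 250`, as the comparison requires.
  obtain ⟨T, -, hTfin, hT⟩ := Metric.finite_approx_of_totallyBounded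
    (isCompact_closedBall (0 : Fin N → E3) 1).totallyBounded (δ / 500) (by positivity)
  have hmem : ∀ γ, IsSimpleClosed γ → IsUnitLoop γ → ∃ c ∈ T, dist (S γ) c < δ / 500 := by
    intro γ hs hu
    have hL := hu.isArcLoop hs
    obtain ⟨t₀, ht₀⟩ : (0 : E3) ∈ range (periodize γ) := by
      rw [range_periodize hu.closed]; exact hu.origin
    have : S γ ∈ Metric.closedBall (0 : Fin N → E3) 1 := by
      rw [mem_closedBall_zero_iff, pi_norm_le_iff_of_nonneg zero_le_one]
      intro k
      obtain ⟨y, hy, hy'⟩ := hL.periodic.exists_mem_Ico (by norm_num) (k * δ) t₀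
      show ‖periodize γ (k * δ)‖ ≤ 1
      rw [hy', ← sub_zero (periodize γ y), ← ht₀]
      refine (hL.norm_map_sub_le _ _).trans ?_
      rw [abs_le]; constructor <;> linarith [hy.1, hy.2]
    have := hT this
    simpa using this
  choose! c hcT hc using hmem
  set A := {κ : KnotType | ∃ (γ : ℝ → E3) (hγ : IsSimpleClosed γ),
      IsUnitLoop γ ∧ IsFlat (trace γ) r (1 / 1000) ∧ knotType γ hγ = κ} with hA
  choose! g hg using fun (κ : KnotType) (hκ : κ ∈ A) => hκ
  refine Set.Finite.of_injOn (f := fun κ => c (g κ)) (t := T) ?_ ?_ hTfin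
  · intro κ hκ
    obtain ⟨hs, hu, -⟩ := hg κ hκ
    exact hcT _ hs hu
  · intro κ hκ κ' hκ' he
    obtain ⟨hs, hu, hf, hk⟩ := hg κ hκ
    obtain ⟨hs', hu', hf', hk'⟩ := hg κ' hκ'
    rw [← hk, ← hk']
    refine Quotient.sound ?_
    show AmbientIsotopic (trace (g κ)) (trace (g κ'))
    rw [← range_periodize hu.closed] at hf ⊢
    rw [← range_periodize hu'.closed] at hf' ⊢
    have hL := hu.isArcLoop hs
    have hL' := hu'.isArcLoop hs'
    refine ambientIsotopic_range_of_norm_sub_le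
      (hL.norm_sub_sub_sub_le hL' hr hr1 hf hf' hδpos hδr ?_)
    have hdist : dist (S (g κ')) (S (g κ)) ≤ δ / 250 := by
      have e1 := hc _ hs hu
      have e2 := hc _ hs' hu'
      simp only at he
      rw [he] at e1
      have := dist_triangle_right (S (g κ')) (S (g κ)) (c (g κ'))
      linarith
    intro k
    have hNZ : (N : ℤ) ≠ 0 := by
      intro h0
      rw [show (N : ℝ) = ((N : ℤ) : ℝ) by simp, h0] at hNpos
      simp at hNpos
    have hNZ' : (0 : ℤ) < N := lt_of_le_of_ne (by positivity) hNZ.symm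
    obtain ⟨j, hj⟩ := Int.eq_ofNat_of_zero_le (Int.emod_nonneg k hNZ)
    have hjN : j < N := by
      have := Int.emod_lt_of_pos k hNZ'
      omega
    -- Since `N * δ = 1`, periodicity reduces every grid point to one of the `N` samples.
    have hk : (k : ℝ) * δ = j * δ + ((k / N : ℤ) : ℝ) := by
      have e1 : (k : ℝ) = (N : ℝ) * ((k / N : ℤ) : ℝ) + j := by
        have := Int.mul_ediv_add_emod k N
        rw [hj] at this
        exact_mod_cast this.symm
      rw [e1, hδ]
      field_simp
      ring
    rw [hk, hL.add_int, hL'.add_int, ← dist_eq_norm]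
    exact (dist_le_pi_dist (S (g κ')) (S (g κ)) ⟨j, hjN⟩).trans hdist

/-! ### From decay of angles at comparable distances to flatness -/

/-- At points whose distances from `x` are comparable to `d ≤ 1`, the chords from `x` deviate from
each other by at most `C d ^ κ`. -/
def HasAngleDecay (K : Set E3) (C κ : ℝ) : Prop :=
  ∀ x ∈ K, ∀ y ∈ K, ∀ z ∈ K, y ≠ x → ‖y - x‖ ≤ 1 → ‖y - x‖ / 4 ≤ ‖z - x‖ →
    ‖z - x‖ ≤ ‖y - x‖ / 2 → sinAngle (y - x) (z - x) ≤ C * ‖y - x‖ ^ κ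

theorem IsPreconnected.exists_norm_sub_eq {K : Set E3} (hK : IsPreconnected K) {x y : E3}
    (hx : x ∈ K) (hy : y ∈ K) {ρ : ℝ} (h0 : 0 ≤ ρ) (h1 : ρ ≤ ‖y - x‖) :
    ∃ z ∈ K, ‖z - x‖ = ρ := by
  have hc : ContinuousOn (fun z : E3 => ‖z - x‖) K := by fun_prop
  have := hK.intermediate_value hx hy hc
  simp only [sub_self, norm_zero] at this
  exact this ⟨h0, h1⟩

/-- Telescoping over halved distances: connectedness supplies a point at exactly half the distance,
and `A` dominates the geometric series with ratio `(1 / 2) ^ κ`. The number `n` only bounds the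
halvings; it does not enter the estimate. -/
theorem HasAngleDecay.sinAngle_le {K : Set E3} (hK : IsPreconnected K) {C κ A : ℝ}
    (h : HasAngleDecay K C κ) (hA0 : 0 ≤ A) (hA : C + A * (1 / 2) ^ κ ≤ A) {x : E3}
    (hx : x ∈ K) (n : ℕ) :
    ∀ y ∈ K, ∀ z ∈ K, z ≠ x → ‖z - x‖ ≤ ‖y - x‖ / 2 → ‖y - x‖ ≤ 1 →
      ‖y - x‖ ≤ 2 ^ n * ‖z - x‖ → sinAngle (y - x) (z - x) ≤ A * ‖y - x‖ ^ κ := by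
  induction n with
  | zero =>
    intro y _ z _ hzx h1 _ h3
    have : 0 < ‖z - x‖ := norm_pos_iff.2 (sub_ne_zero.2 hzx)
    simp only [pow_zero, one_mul] at h3
    linarith
  | succ n ih =>
    intro y hy z hz hzx h1 h2 h3
    have hz0 : 0 < ‖z - x‖ := norm_pos_iff.2 (sub_ne_zero.2 hzx)
    have hy0 : 0 < ‖y - x‖ := by linarith
    have hyx : y ≠ x := sub_ne_zero.1 (norm_pos_iff.1 hy0)
    have hpow : 0 ≤ ‖y - x‖ ^ κ := Real.rpow_nonneg hy0.le κ
    have hhalf : 0 ≤ A * (1 / 2 : ℝ) ^ κ := mul_nonneg hA0 (Real.rpow_nonneg (by norm_num) κ)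
    rcases le_total (‖y - x‖ / 4) ‖z - x‖ with h4 | h4
    · refine (h x hx y hy z hz hyx h2 h4 h1).trans ?_
      gcongr
      linarith
    · obtain ⟨y', hy', hd⟩ := IsPreconnected.exists_norm_sub_eq hK hx hy (ρ := ‖y - x‖ / 2)
        (by linarith) (by linarith)
      have e1 := h x hx y hy y' hy' hyx h2 (by linarith) (by linarith)
      have e2 := ih y' hy' z hz hzx (by linarith) (by linarith) (by
        rw [hd]; rw [pow_succ] at h3; linarith)
      rw [hd, div_eq_mul_one_div ‖y - x‖, Real.mul_rpow hy0.le (by norm_num)] at e2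
      have e3 := sinAngle_triangle (y - x) (y' - x) (z - x)
      calc sinAngle (y - x) (z - x) ≤ (C + A * (1 / 2) ^ κ) * ‖y - x‖ ^ κ := by linarith
        _ ≤ A * ‖y - x‖ ^ κ := by gcongr

/-- Angle decay implies flatness up to a scale that depends only on the rate of decay. -/
theorem exists_isFlat_of_hasAngleDecay {C κ : ℝ} (hC : 0 ≤ C) (hκ : 0 < κ) {ε : ℝ} (hε : 0 < ε) :
    ∃ r > 0, ∀ K : Set E3, IsPreconnected K → HasAngleDecay K C κ → IsFlat K r ε := by
  have hq : (1 / 2 : ℝ) ^ κ < 1 := Real.rpow_lt_one (by norm_num) (by norm_num) hκ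
  set A : ℝ := C / (1 - (1 / 2) ^ κ) with hA
  have hA0 : 0 ≤ A := div_nonneg hC (by linarith)
  have hAC : C + A * (1 / 2) ^ κ ≤ A := by
    have : A * (1 - (1 / 2) ^ κ) = C := div_mul_cancel₀ _ (by linarith)
    linarith
  -- Chosen so that `2 * A * r ^ κ ≤ ε`; the summand `1` covers `A = 0`.
  set r : ℝ := min 1 ((ε / (2 * A + 1)) ^ (1 / κ)) with hr
  have hr0 : 0 < r := lt_min one_pos (by positivity)
  have hrκ : 2 * A * r ^ κ ≤ ε := by
    have h1 : r ^ κ ≤ ε / (2 * A + 1) := by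
      calc r ^ κ ≤ ((ε / (2 * A + 1)) ^ (1 / κ)) ^ κ :=
            Real.rpow_le_rpow hr0.le (min_le_right _ _) hκ.le
        _ = ε / (2 * A + 1) := by
            rw [← Real.rpow_mul (by positivity), one_div_mul_cancel hκ.ne', Real.rpow_one]
    calc 2 * A * r ^ κ ≤ (2 * A + 1) * (ε / (2 * A + 1)) := by gcongr; linarith
      _ = ε := mul_div_cancel₀ _ (by positivity)
  refine ⟨r, hr0, fun K hK h => ?_⟩
  have key : ∀ x ∈ K, ∀ y ∈ K, ∀ z ∈ K, z ≠ x → ‖z - x‖ ≤ ‖y - x‖ → ‖y - x‖ ≤ r →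
      sinAngle (y - x) (z - x) ≤ ε := by
    intro x hx y hy z hz hzx hzy hyr
    have hz0 : 0 < ‖z - x‖ := norm_pos_iff.2 (sub_ne_zero.2 hzx)
    -- The telescoped bound needs a distance ratio of at most `1 / 2`, so `y` and `z` are both
    -- compared with a nearer point.
    obtain ⟨y', hy', hd⟩ := IsPreconnected.exists_norm_sub_eq hK hx hz (ρ := ‖z - x‖ / 2)
      (by linarith) (by linarith)
    have hy'x : y' ≠ x := sub_ne_zero.1 (norm_pos_iff.1 (by linarith))
    have hall : ∀ w ∈ K, ‖z - x‖ ≤ ‖w - x‖ → ‖w - x‖ ≤ r →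
        sinAngle (w - x) (y' - x) ≤ A * r ^ κ := by
      intro w hw h1 h2
      obtain ⟨n, hn⟩ := pow_unbounded_of_one_lt (‖w - x‖ / ‖y' - x‖) one_lt_two
      refine (h.sinAngle_le hK hA0 hAC hx n w hw y' hy' hy'x (by linarith)
        (h2.trans (min_le_left _ _)) ?_).trans ?_
      · rw [div_lt_iff₀ (by linarith)] at hn
        exact hn.le
      · gcongr
    have e1 := hall y hy hzy hyr
    have e2 := hall z hz le_rfl (hzy.trans hyr)
    have e3 := sinAngle_triangle (y - x) (y' - x) (z - x)
    rw [sinAngle_comm (y' - x)] at e3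
    linarith
  intro x hx y hy z hz hyx hzx hyr hzr
  rcases le_total ‖z - x‖ ‖y - x‖ with hle | hle
  · exact key x hx y hy z hz hzx hle hyr
  · rw [sinAngle_comm]; exact key x hx z hz y hy hyx hle hzr

/-- If the simple unit loops of bounded energy have a uniform decay of angles, then they represent
only finitely many knot types. -/
theorem finitelyManyKnotTypes_of_hasAngleDecay {energy : (ℝ → E3) → ℝ≥0∞}
    (h : ∀ E : ℝ≥0, ∃ C ≥ 0, ∃ κ > 0, ∀ γ : ℝ → E3, IsSimpleClosed γ → IsUnitLoop γ →
      energy γ ≤ E → HasAngleDecay (trace γ) C κ) : FinitelyManyKnotTypes energy := by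
  intro E
  obtain ⟨C, hC, κ, hκ, hdecay⟩ := h E
  obtain ⟨r, hr, hflat⟩ := exists_isFlat_of_hasAngleDecay hC hκ (ε := 1 / 1000) (by norm_num)
  refine (finite_knotTypes_of_isFlat hr).subset ?_
  rintro κ ⟨γ, hγ, hu, hE, hκ⟩
  exact ⟨γ, hγ, hu, hflat _ (isPreconnected_Icc.image γ hγ.continuousOn) (hdecay γ hγ hu hE), hκ⟩

/-! ### From energy bounds to angle decay. -/

/-- The relation between angle and distance that results from an energy bound. -/
theorem le_mul_rpow_of_energy_le {n : ℕ} {p a b E θ d : ℝ} (ha : 0 < a) (hb : 0 < b)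
    (hE : 0 ≤ E) (hn : (n : ℝ) < p) (hθ : 0 < θ) (hd : 0 < d)
    (h : (a * (θ * d)) ^ n * (b * (θ / d)) ^ p ≤ E) :
    θ ≤ (E / (a ^ n * b ^ p)) ^ (1 / (n + p)) * d ^ ((p - n) / (n + p)) := by
  have hnp : 0 < n + p := by
    have : (0 : ℝ) ≤ n := Nat.cast_nonneg n
    linarith
  have h1 : θ ^ (n + p) ≤ E / (a ^ n * b ^ p) * d ^ (p - n) := by
    rw [div_mul_eq_mul_div, le_div_iff₀ (by positivity)]
    have e : (a * (θ * d)) ^ n * (b * (θ / d)) ^ p * d ^ (p - n) =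
        θ ^ (n + p) * (a ^ n * b ^ p) := by
      rw [Real.rpow_sub hd, Real.rpow_add hθ, Real.mul_rpow hb.le (by positivity),
        Real.div_rpow hθ.le hd.le, Real.rpow_natCast, Real.rpow_natCast, mul_pow, mul_pow]
      have : 0 < d ^ p := by positivity
      field_simp
    rw [← e]
    gcongr
  calc θ = (θ ^ (n + p)) ^ (1 / (n + p)) := by
        rw [← Real.rpow_mul hθ.le, mul_one_div_cancel hnp.ne', Real.rpow_one]
    _ ≤ (E / (a ^ n * b ^ p) * d ^ (p - n)) ^ (1 / (n + p)) := by gcongr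
    _ = _ := by
        rw [Real.mul_rpow (by positivity) (by positivity), ← Real.rpow_mul hd.le, mul_one_div]

/-- Angle decay follows from a uniform lower bound of the energy in terms of the angle and the
distances. -/
theorem finitelyManyKnotTypes_of_le_energy {energy : (ℝ → E3) → ℝ≥0∞} {n : ℕ} {p a b : ℝ}
    (ha : 0 < a) (hb : 0 < b) (hn : (n : ℝ) < p)
    (h : ∀ γ : ℝ → E3, IsSimpleClosed γ → IsUnitLoop γ → ∀ x ∈ trace γ, ∀ y ∈ trace γ,
      ∀ z ∈ trace γ, ∀ d > 0, ‖y - x‖ = d → d ≤ 1 → d / 4 ≤ ‖z - x‖ → ‖z - x‖ ≤ d / 2 →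
      ∀ θ > 0, sinAngle (y - x) (z - x) = θ →
      ENNReal.ofReal (a * (θ * d)) ^ n * (ENNReal.ofReal ((b * (θ / d))⁻¹) ^ p)⁻¹ ≤ energy γ) :
    FinitelyManyKnotTypes energy := by
  refine finitelyManyKnotTypes_of_hasAngleDecay fun E => ?_
  have hn0 : (0 : ℝ) ≤ n := Nat.cast_nonneg n
  refine ⟨(E / (a ^ n * b ^ p)) ^ (1 / (n + p)), by positivity, (p - n) / (n + p),
    div_pos (by linarith) (by linarith), fun γ hγ hu hE x hx y hy z hz hyx h1 h2 h3 => ?_⟩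
  have hd : 0 < ‖y - x‖ := norm_pos_iff.2 (sub_ne_zero.2 hyx)
  rcases eq_or_lt_of_le (sinAngle_nonneg (y - x) (z - x)) with hθ | hθ
  · rw [← hθ]; positivity
  refine le_mul_rpow_of_energy_le ha hb E.2 hn hθ hd ?_
  have := (h γ hγ hu x hx y hy z hz _ hd rfl h1 h2 h3 _ hθ rfl).trans hE
  have hq : 0 < b * (sinAngle (y - x) (z - x) / ‖y - x‖) := by positivity
  rw [ENNReal.ofReal_rpow_of_pos (by positivity), ← ENNReal.ofReal_inv_of_pos (by positivity),
    ← Real.inv_rpow (by positivity), inv_inv, ← ENNReal.ofReal_pow (by positivity),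
    ← ENNReal.ofReal_mul (by positivity), ← ENNReal.ofReal_coe_nnreal] at this
  exact (ENNReal.ofReal_le_ofReal_iff E.2).1 this

/-! ### Lower bounds for integrals along the curve -/

section CurveMeasure

variable {γ : ℝ → E3}

/-- The image of the complement of `B` is no larger than the complement itself, and the total length
is one on both sides. -/
theorem IsUnitLoop.volume_le_hausdorffMeasure_image (hu : IsUnitLoop γ) {B : Set ℝ}
    (hB : MeasurableSet B) (hB1 : B ⊆ Icc 0 1) : volume B ≤ μH[1] (γ '' B) := by
  have hlip := hu.lipschitzOnWith_one
  have h1 : trace γ ⊆ γ '' B ∪ γ '' (Icc 0 1 \ B) := by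
    rw [← image_union, union_sdiff_cancel hB1, trace]
  have h2 := (measure_mono h1).trans (measure_union_le (μ := (μH[1] : Measure E3)) _ _)
  have h3 : μH[1] (γ '' (Icc 0 1 \ B)) ≤ volume (Icc 0 1 \ B) := by
    simpa [hausdorffMeasure_real] using
      (hlip.mono sdiff_subset).hausdorffMeasure_image_le (zero_le_one (α := ℝ))
  have h4 : volume B + volume (Icc (0 : ℝ) 1 \ B) = 1 := by
    rw [← measure_union disjoint_sdiff_right (measurableSet_Icc.diff hB), union_sdiff_cancel hB1]
    simp
  rw [hu.hausdorff, ← h4] at h2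
  have h5 := h2.trans (add_le_add_right h3 _)
  refine (ENNReal.add_le_add_iff_right ?_).1 h5
  exact ne_top_of_le_ne_top ENNReal.one_ne_top (h4 ▸ le_add_self)

/-- Only `γ '' B` has to be measurable, which injectivity ensures; `f` is arbitrary, so
measurability of the radii never matters. -/
theorem IsUnitLoop.mul_volume_le_lintegral (hs : IsSimpleClosed γ) (hu : IsUnitLoop γ) {B : Set ℝ}
    (hB : MeasurableSet B) (hB1 : B ⊆ Ioo 0 1) {f : E3 → ℝ≥0∞} {c : ℝ≥0∞}
    (hf : ∀ t ∈ B, c ≤ f (γ t)) : volume B * c ≤ ∫⁻ x, f x ∂(curveMeasure γ) := by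
  have hsub : γ '' B ⊆ trace γ := image_mono (hB1.trans Ioo_subset_Icc_self)
  have hm : MeasurableSet (γ '' B) :=
    hB.image_of_continuousOn_injOn (hs.continuousOn.mono (hB1.trans Ioo_subset_Icc_self))
      (hs.injOn.mono (hB1.trans Ioo_subset_Ico_self))
  calc volume B * c ≤ c * μH[1] (γ '' B) := by
        rw [mul_comm]
        gcongr
        exact hu.volume_le_hausdorffMeasure_image hB (hB1.trans Ioo_subset_Icc_self)
    _ = ∫⁻ _ in γ '' B, c ∂(μH[1] : Measure E3) := by rw [setLIntegral_const]
    _ ≤ ∫⁻ x in γ '' B, f x ∂(μH[1] : Measure E3) := by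
        refine setLIntegral_mono' hm ?_
        rintro _ ⟨t, ht, rfl⟩
        exact hf t ht
    _ ≤ ∫⁻ x, f x ∂(curveMeasure γ) := lintegral_mono_set hsub

/-- Every point of a unit loop is an end point of short arcs. -/
theorem IsUnitLoop.exists_Ioo (hu : IsUnitLoop γ) {x : E3} (hx : x ∈ trace γ) {h : ℝ} (h0 : 0 < h)
    (h1 : h ≤ 1 / 2) : ∃ a, Ioo a (a + h) ⊆ Ioo 0 1 ∧ ∀ t ∈ Ioo a (a + h), ‖γ t - x‖ ≤ h := by
  obtain ⟨s, hs, rfl⟩ := hx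
  have key : ∀ t ∈ Icc (0 : ℝ) 1, |t - s| ≤ h → ‖γ t - γ s‖ ≤ h := by
    intro t ht hts
    have := hu.lipschitzOnWith_one.dist_le_mul t ht s hs
    rw [NNReal.coe_one, one_mul, Real.dist_eq, dist_eq_norm] at this
    exact this.trans hts
  -- The arc runs forward or backward from `s`, so that it stays inside `(0, 1)`.
  rcases le_total s (1 / 2) with h2 | h2
  · have hsub : Ioo s (s + h) ⊆ Ioo 0 1 := Ioo_subset_Ioo hs.1 (by linarith)
    refine ⟨s, hsub, fun t ht => key t (Ioo_subset_Icc_self (hsub ht)) ?_⟩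
    rw [abs_le]; constructor <;> linarith [ht.1, ht.2]
  · have hsub : Ioo (s - h) (s - h + h) ⊆ Ioo 0 1 :=
      Ioo_subset_Ioo (by linarith) (by linarith [hs.2])
    refine ⟨s - h, hsub, fun t ht => key t (Ioo_subset_Icc_self (hsub ht)) ?_⟩
    rw [abs_le]; constructor <;> linarith [ht.1, ht.2]

end CurveMeasure

/-! ### Energies built from the circumradius -/

/-- Law of sines; a positive sine excludes collinearity, hence the value `∞`. -/
theorem circumradius_le {x y z : E3} {s : ℝ} (hs : 0 < s) (hyx : y ≠ x) (hzx : z ≠ x)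
    (h : s ≤ sinAngle (y - x) (z - x)) :
    circumradius x y z ≤ ENNReal.ofReal (‖y - z‖ / (2 * s)) := by
  have hang : sinAngle (y - x) (z - x) = Real.sin (EuclideanGeometry.angle y x z) := rfl
  have haff : AffineIndependent ℝ ![x, y, z] := by
    rw [affineIndependent_iff_not_collinear_set, insert_comm,
      EuclideanGeometry.collinear_iff_eq_or_eq_or_sin_eq_zero]
    rintro (h1 | h1 | h1)
    · exact hyx h1
    · exact hzx h1
    · rw [hang, h1] at h
      linarith
  rw [circumradius, dif_pos haff]
  have h1 := Affine.Triangle.dist_div_sin_angle_eq_two_mul_circumradius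
    (⟨![x, y, z], haff⟩ : Affine.Simplex ℝ E3 2) (i₁ := 1) (i₂ := 0) (i₃ := 2)
    (by decide) (by decide) (by decide)
  have h2 : dist y z / sinAngle (y - x) (z - x) =
      2 * Affine.Simplex.circumradius (⟨![x, y, z], haff⟩ : Affine.Simplex ℝ E3 2) := h1
  refine ENNReal.ofReal_le_ofReal ?_
  rw [dist_eq_norm] at h2
  have h3 : ‖y - z‖ / sinAngle (y - x) (z - x) ≤ ‖y - z‖ / s := by gcongr
  have h4 : ‖y - z‖ / (2 * s) = ‖y - z‖ / s / 2 := by rw [mul_comm, div_div]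
  rw [h4]
  linarith

theorem sub_le_norm_sub_of_norm_sub_le {x y x' y' : E3} {h : ℝ} (hx : ‖x' - x‖ ≤ h)
    (hy : ‖y' - y‖ ≤ h) : ‖y - x‖ - 2 * h ≤ ‖y' - x'‖ := by
  have e : y - x = (y' - x') - (y' - y) + (x' - x) := by abel
  have := norm_add_le ((y' - x') - (y' - y)) (x' - x)
  have := norm_sub_le (y' - x') (y' - y)
  rw [← e] at *
  linarith

theorem norm_sub_le_add_of_norm_sub_le {x y x' y' : E3} {h : ℝ} (hx : ‖x' - x‖ ≤ h)
    (hy : ‖y' - y‖ ≤ h) : ‖y' - x'‖ ≤ ‖y - x‖ + 2 * h := by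
  have := sub_le_norm_sub_of_norm_sub_le (x := x') (y := y') (x' := x) (y' := y) (h := h)
    (by rwa [norm_sub_rev]) (by rwa [norm_sub_rev])
  linarith

/-- The direction of a chord changes little when its end points are perturbed. -/
theorem sinAngle_sub_sub_le {x y x' y' : E3} {h c : ℝ} (hx : ‖x' - x‖ ≤ h)
    (hy : ‖y' - y‖ ≤ h) (hyx : y ≠ x) (hc : 2 * h ≤ c * ‖y - x‖) :
    sinAngle (y - x) (y' - x') ≤ c := by
  have hpos : 0 < ‖y - x‖ := norm_pos_iff.2 (sub_ne_zero.2 hyx)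
  have h1 := sinAngle_mul_norm_le_sub (y - x) (y' - x')
  have e : y - x - (y' - x') = (x' - x) - (y' - y) := by abel
  rw [e] at h1
  have h2 := norm_sub_le (x' - x) (y' - y)
  exact le_of_mul_le_mul_right (by linarith) hpos

/-- The circumradius is controlled near a triangle with comparable sides. -/
theorem circumradius_le_of_near {x y z : E3} {d θ : ℝ} (hd : 0 < d) (hyx : ‖y - x‖ = d)
    (hzx : d / 4 ≤ ‖z - x‖) (hzx' : ‖z - x‖ ≤ d / 2) (hθ : 0 < θ)
    (hs : sinAngle (y - x) (z - x) = θ) {x' y' z' : E3} (hx : ‖x' - x‖ ≤ 1 / 20 * (θ * d))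
    (hy : ‖y' - y‖ ≤ 1 / 20 * (θ * d)) (hz : ‖z' - z‖ ≤ 1 / 20 * (θ * d)) :
    (x' ≠ y' ∧ y' ≠ z' ∧ z' ≠ x') ∧
      circumradius x' y' z' ≤ ENNReal.ofReal ((1 / 2 * (θ / d))⁻¹) := by
  have hθ1 : θ ≤ 1 := hs ▸ sinAngle_le_one _ _
  have hθd : θ * d ≤ d := mul_le_of_le_one_left hd.le hθ1
  have hyx0 : y ≠ x := sub_ne_zero.1 (norm_pos_iff.1 (hyx ▸ hd))
  have hzx0 : z ≠ x := sub_ne_zero.1 (norm_pos_iff.1 (by linarith))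
  have hyz : ‖y - z‖ ≤ 3 / 2 * d := by
    have := norm_sub_le_norm_sub_add_norm_sub y x z
    rw [norm_sub_rev x z] at this
    linarith
  have hyz' : d / 2 ≤ ‖y - z‖ := by
    have := norm_sub_le_norm_sub_add_norm_sub y z x
    linarith
  have e1 := sub_le_norm_sub_of_norm_sub_le hx hy
  have e2 := sub_le_norm_sub_of_norm_sub_le hx hz
  have e3 := sub_le_norm_sub_of_norm_sub_le hz hy
  have e4 := norm_sub_le_add_of_norm_sub_le hz hy
  have n1 : y' ≠ x' := sub_ne_zero.1 (norm_pos_iff.1 (by linarith))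
  have n2 : z' ≠ x' := sub_ne_zero.1 (norm_pos_iff.1 (by linarith))
  have n3 : y' ≠ z' := sub_ne_zero.1 (norm_pos_iff.1 (by linarith))
  refine ⟨⟨n1.symm, n3, n2⟩, ?_⟩
  -- The two sides at `x` have lengths `d` and at least `d / 4`, so they turn by at most `θ / 10`
  -- and `4 * θ / 10`; half of `θ` survives.
  have s1 := sinAngle_sub_sub_le hx hy hyx0 (c := θ / 10) (by rw [hyx]; linarith)
  have s2 := sinAngle_sub_sub_le hx hz hzx0 (c := 4 * θ / 10) (by nlinarith)
  have t1 := sinAngle_triangle (y - x) (y' - x') (z - x)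
  have t2 := sinAngle_triangle (y' - x') (z' - x') (z - x)
  rw [sinAngle_comm (z' - x')] at t2
  have hsin : θ / 2 ≤ sinAngle (y' - x') (z' - x') := by linarith
  refine (circumradius_le (by positivity) n1 n2 hsin).trans (ENNReal.ofReal_le_ofReal ?_)
  have : (1 / 2 * (θ / d))⁻¹ = 2 * d / θ := by field_simp
  rw [this]
  have : 2 * (θ / 2) = θ := by ring
  rw [this]
  gcongr
  linarith

theorem inv_rpow_le_inv_rpow {a b : ℝ≥0∞} {p : ℝ} (hp : 0 ≤ p) (h : a ≤ b) :
    (b ^ p)⁻¹ ≤ (a ^ p)⁻¹ :=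
  ENNReal.inv_le_inv.2 (ENNReal.rpow_le_rpow h hp)

theorem finitelyManyKnotTypes_energyM {p : ℝ} (hp : 3 < p) :
    FinitelyManyKnotTypes (energyM p) := by
  refine finitelyManyKnotTypes_of_le_energy (n := 3) (a := 1 / 20) (b := 1 / 2) (by norm_num)
    (by norm_num) (by exact_mod_cast hp) ?_
  intro γ hγ hu x hx y hy z hz d hd hyx hd1 hzx hzx' θ hθ hs
  have hθ1 : θ ≤ 1 := hs ▸ sinAngle_le_one _ _
  have hh : 1 / 20 * (θ * d) ≤ 1 / 2 := by nlinarith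
  obtain ⟨a, ha, hax⟩ := hu.exists_Ioo hx (h := 1 / 20 * (θ * d)) (by positivity) hh
  obtain ⟨b, hb, hby⟩ := hu.exists_Ioo hy (h := 1 / 20 * (θ * d)) (by positivity) hh
  obtain ⟨c, hc, hcz⟩ := hu.exists_Ioo hz (h := 1 / 20 * (θ * d)) (by positivity) hh
  have hvol : ∀ q : ℝ, volume (Ioo q (q + 1 / 20 * (θ * d))) =
      ENNReal.ofReal (1 / 20 * (θ * d)) := fun q => by simp
  rw [pow_succ', pow_succ', pow_one, mul_assoc, mul_assoc]
  nth_rewrite 1 [← hvol a]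
  refine hu.mul_volume_le_lintegral hγ measurableSet_Ioo ha fun s hs' => ?_
  nth_rewrite 1 [← hvol b]
  refine hu.mul_volume_le_lintegral hγ measurableSet_Ioo hb fun t ht => ?_
  rw [← hvol c]
  refine hu.mul_volume_le_lintegral hγ measurableSet_Ioo hc fun u hu' => ?_
  exact inv_rpow_le_inv_rpow (by linarith)
    (circumradius_le_of_near hd hyx hzx hzx' hθ hs (hax s hs') (hby t ht) (hcz u hu')).2

/-- Only `x` and `y` move along arcs; the fixed `z` competes in the infimum. Hence two factors of
length instead of three. -/
theorem finitelyManyKnotTypes_energyI {p : ℝ} (hp : 2 < p) :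
    FinitelyManyKnotTypes (energyI p) := by
  refine finitelyManyKnotTypes_of_le_energy (n := 2) (a := 1 / 20) (b := 1 / 2) (by norm_num)
    (by norm_num) (by exact_mod_cast hp) ?_
  intro γ hγ hu x hx y hy z hz d hd hyx hd1 hzx hzx' θ hθ hs
  have hθ1 : θ ≤ 1 := hs ▸ sinAngle_le_one _ _
  have hh : 1 / 20 * (θ * d) ≤ 1 / 2 := by nlinarith
  obtain ⟨a, ha, hax⟩ := hu.exists_Ioo hx (h := 1 / 20 * (θ * d)) (by positivity) hh
  obtain ⟨b, hb, hby⟩ := hu.exists_Ioo hy (h := 1 / 20 * (θ * d)) (by positivity) hh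
  have hvol : ∀ q : ℝ, volume (Ioo q (q + 1 / 20 * (θ * d))) =
      ENNReal.ofReal (1 / 20 * (θ * d)) := fun q => by simp
  rw [sq, mul_assoc]
  nth_rewrite 1 [← hvol a]
  refine hu.mul_volume_le_lintegral hγ measurableSet_Ioo ha fun s hs' => ?_
  rw [← hvol b]
  refine hu.mul_volume_le_lintegral hγ measurableSet_Ioo hb fun t ht => ?_
  obtain ⟨hne, hle⟩ := circumradius_le_of_near hd hyx hzx hzx' hθ hs (hax s hs') (hby t ht)
    (z' := z) (by simpa using by positivity)
  exact inv_rpow_le_inv_rpow (by linarith) ((iInf₂_le_of_le z hz (iInf_le _ hne)).trans hle)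

theorem finitelyManyKnotTypes_energyU {p : ℝ} (hp : 1 < p) :
    FinitelyManyKnotTypes (energyU p) := by
  refine finitelyManyKnotTypes_of_le_energy (n := 1) (a := 1 / 20) (b := 1 / 2) (by norm_num)
    (by norm_num) (by exact_mod_cast hp) ?_
  intro γ hγ hu x hx y hy z hz d hd hyx hd1 hzx hzx' θ hθ hs
  have hθ1 : θ ≤ 1 := hs ▸ sinAngle_le_one _ _
  have hh : 1 / 20 * (θ * d) ≤ 1 / 2 := by nlinarith
  obtain ⟨a, ha, hax⟩ := hu.exists_Ioo hx (h := 1 / 20 * (θ * d)) (by positivity) hh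
  have hvol : ∀ q : ℝ, volume (Ioo q (q + 1 / 20 * (θ * d))) =
      ENNReal.ofReal (1 / 20 * (θ * d)) := fun q => by simp
  rw [pow_one, ← hvol a]
  refine hu.mul_volume_le_lintegral hγ measurableSet_Ioo ha fun s hs' => ?_
  obtain ⟨hne, hle⟩ := circumradius_le_of_near hd hyx hzx hzx' hθ hs (hax s hs')
    (y' := y) (z' := z) (by simpa using by positivity) (by simpa using by positivity)
  exact inv_rpow_le_inv_rpow (by linarith)
    ((iInf₂_le_of_le y hy (iInf₂_le_of_le z hz (iInf_le _ hne))).trans hle)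

/-! ### Tangent-point energies -/

/-- The parameters in `(a, a + h)` at which `γ` has a unit tangent vector whose direction deviates
from that of `u` by more than `l`. -/
def deviationSet (γ : ℝ → E3) (a h : ℝ) (u : E3) (l : ℝ) : Set ℝ :=
  {t | t ∈ Ioo a (a + h) ∧ ‖deriv γ t‖ = 1 ∧ l < sinAngle (deriv γ t) u}

section

variable {γ : ℝ → E3}

theorem measurableSet_deviationSet (γ : ℝ → E3) (a h : ℝ) (u : E3) (l : ℝ) :
    MeasurableSet (deviationSet γ a h u l) := by
  have hd := measurable_deriv γ
  have h1 : Measurable fun t => sinAngle (deriv γ t) u := by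
    unfold sinAngle InnerProductGeometry.angle
    have : Measurable fun t => inner ℝ (deriv γ t) u := hd.inner measurable_const
    exact Real.measurable_sin.comp (Real.measurable_arccos.comp
      (this.div (hd.norm.mul measurable_const)))
  exact measurableSet_Ioo.inter
    ((hd.norm (measurableSet_singleton 1)).inter (measurableSet_lt measurable_const h1))

/-- If on more than half of a parameter interval the tangent is close to `u`, and on more than half
of it close to `u'`, then `u` and `u'` have close directions. -/
theorem IsUnitLoop.sinAngle_le_of_volume_lt (hu : IsUnitLoop γ) {a h l : ℝ} {u u' : E3}
    (ha : Ioo a (a + h) ⊆ Ioo 0 1) (h1 : volume (deviationSet γ a h u l) < ENNReal.ofReal (h / 2))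
    (h2 : volume (deviationSet γ a h u' l) < ENNReal.ofReal (h / 2)) :
    sinAngle u u' ≤ 2 * l := by
  by_contra! hcon
  have hae := (ae_restrict_iff' measurableSet_Icc).1 hu.unitSpeed
  rw [ae_iff] at hae
  have hh : 0 < h / 2 := by
    by_contra! hneg
    rw [ENNReal.ofReal_of_nonpos hneg] at h1
    exact not_lt_bot h1
  -- A parameter outside both deviation sets would have a tangent close to `u` and to `u'`. So these
  -- sets and a null set cover the interval, although their total measure is too small.
  have hcov : Ioo a (a + h) ⊆ deviationSet γ a h u l ∪ deviationSet γ a h u' l ∪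
      {t | ¬(t ∈ Icc (0 : ℝ) 1 → ‖deriv γ t‖ = 1)} := by
    intro t ht
    by_cases h3 : t ∈ Icc (0 : ℝ) 1 → ‖deriv γ t‖ = 1
    · have hn := h3 (Ioo_subset_Icc_self (ha ht))
      left
      by_contra! h4
      simp only [mem_union, not_or] at h4
      have e1 : sinAngle (deriv γ t) u ≤ l := by
        by_contra! h5; exact h4.1 ⟨ht, hn, h5⟩
      have e2 : sinAngle (deriv γ t) u' ≤ l := by
        by_contra! h5; exact h4.2 ⟨ht, hn, h5⟩
      have e3 := sinAngle_triangle u (deriv γ t) u'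
      rw [sinAngle_comm u (deriv γ t)] at e3
      linarith
    · exact Or.inr h3
  have h3 := measure_mono (μ := volume) hcov
  have h4 := h3.trans ((measure_union_le _ _).trans
    (add_le_add (measure_union_le _ _) hae.le))
  rw [add_zero, Real.volume_Ioo] at h4
  have h5 := h4.trans_lt (ENNReal.add_lt_add h1 h2)
  rw [← ENNReal.ofReal_add hh.le hh.le] at h5
  have : a + h - a = h / 2 + h / 2 := by ring
  rw [this] at h5
  exact lt_irrefl _ h5

/-- By injectivity `t` is the only parameter of its point, so the tangent line has direction `deriv
γ t`. Without a derivative the line is empty and the radius is `0`. -/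
theorem tangentPointRadius_le (hs : IsSimpleClosed γ) {t : ℝ} (ht : t ∈ Ioo (0 : ℝ) 1) {y : E3}
    (hy : y ≠ γ t) {s : ℝ} (hs0 : 0 < s)
    (h : s ≤ sinAngle (deriv γ t) (y - γ t)) :
    tangentPointRadius γ (γ t) y ≤ ENNReal.ofReal (‖y - γ t‖ / (2 * s)) := by
  have hpos : 0 < ‖y - γ t‖ := norm_pos_iff.2 (sub_ne_zero.2 hy)
  have hinf : ENNReal.ofReal (s * ‖y - γ t‖) ≤ Metric.infEDist y (tangentLine γ (γ t)) := by
    rw [Metric.le_infEDist]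
    rintro w ⟨t', ht', he, -, τ, rfl⟩
    rw [hs.injOn (Ioo_subset_Ico_self ht') (Ioo_subset_Ico_self ht) he, edist_dist, dist_eq_norm,
      ← sub_sub]
    refine ENNReal.ofReal_le_ofReal ?_
    have := sinAngle_mul_norm_le (y - γ t) (deriv γ t) τ
    rw [sinAngle_comm] at this
    exact le_trans (by gcongr) this
  have e1 : ENNReal.ofReal (‖y - γ t‖ / (2 * s)) =
      ENNReal.ofReal ‖y - γ t‖ ^ 2 / (2 * ENNReal.ofReal (s * ‖y - γ t‖)) := by
    generalize ‖y - γ t‖ = q at hpos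
    have e2 : (2 : ℝ≥0∞) = ENNReal.ofReal 2 := by simp
    rw [e2, ← ENNReal.ofReal_mul (by norm_num), ← ENNReal.ofReal_pow hpos.le,
      ← ENNReal.ofReal_div_of_pos (by positivity)]
    congr 1
    field_simp
  rw [e1, tangentPointRadius, edist_dist, dist_eq_norm]
  gcongr

/-- The tangent-point radius is controlled on the deviation set of a chord. -/
theorem tangentPointRadius_le_of_mem_deviationSet (hs : IsSimpleClosed γ) {d l a : ℝ} {v w y : E3}
    (hd : 0 < d) (hl : 0 < l) (hl1 : l ≤ 1) (h1 : d / 8 ≤ ‖w - v‖) (h2 : ‖w - v‖ ≤ 3 / 2 * d)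
    (ha : Ioo a (a + l * d / 32) ⊆ Ioo 0 1)
    (hv : ∀ t ∈ Ioo a (a + l * d / 32), ‖γ t - v‖ ≤ l * d / 32) (hy : ‖y - w‖ ≤ l * d / 32)
    {t : ℝ} (ht : t ∈ deviationSet γ a (l * d / 32) (w - v) l) :
    tangentPointRadius γ (γ t) y ≤ ENNReal.ofReal ((1 / 2 * (l / d))⁻¹) := by
  obtain ⟨ht1, -, ht3⟩ := ht
  have hld : l * d ≤ d := mul_le_of_le_one_left hd.le hl1
  have hx := hv t ht1
  have e1 := sub_le_norm_sub_of_norm_sub_le hx hy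
  have e2 := norm_sub_le_add_of_norm_sub_le hx hy
  have hwv : w ≠ v := sub_ne_zero.1 (norm_pos_iff.1 (by linarith))
  have hyt : y ≠ γ t := sub_ne_zero.1 (norm_pos_iff.1 (by linarith))
  -- Moving both ends of a chord of length at least `d / 8` by `l * d / 32` turns it by at most `l /
  -- 2`, half of the deviation `l`.
  have e3 := sinAngle_sub_sub_le hx hy hwv (c := l / 2) (by nlinarith)
  have e4 := sinAngle_triangle (deriv γ t) (y - γ t) (w - v)
  rw [sinAngle_comm (y - γ t)] at e4
  refine (tangentPointRadius_le hs (ha ht1) hyt (s := l / 2) (by positivity) (by linarith)).trans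
    (ENNReal.ofReal_le_ofReal ?_)
  have : (1 / 2 * (l / d))⁻¹ = 2 * d / l := by field_simp
  rw [this, mul_div_cancel₀ _ two_ne_zero]
  gcongr
  linarith

/-- Lower bound for the tangent-point energy. -/
theorem IsUnitLoop.le_energyTP (hs : IsSimpleClosed γ) (hu : IsUnitLoop γ) {p : ℝ} (hp : 0 ≤ p)
    {d l a b : ℝ} {v w : E3}
    (hd : 0 < d) (hl : 0 < l) (hl1 : l ≤ 1) (h1 : d / 8 ≤ ‖w - v‖) (h2 : ‖w - v‖ ≤ 3 / 2 * d)
    (ha : Ioo a (a + l * d / 32) ⊆ Ioo 0 1)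
    (hv : ∀ t ∈ Ioo a (a + l * d / 32), ‖γ t - v‖ ≤ l * d / 32)
    (hb : Ioo b (b + l * d / 32) ⊆ Ioo 0 1)
    (hw : ∀ t ∈ Ioo b (b + l * d / 32), ‖γ t - w‖ ≤ l * d / 32)
    (hdev : ENNReal.ofReal (l * d / 32 / 2) ≤
      volume (deviationSet γ a (l * d / 32) (w - v) l)) :
    ENNReal.ofReal (l * d / 32 / 2) ^ 2 * (ENNReal.ofReal ((1 / 2 * (l / d))⁻¹) ^ p)⁻¹ ≤
      energyTP p γ := by
  have hb' : ENNReal.ofReal (l * d / 32 / 2) ≤ volume (Ioo b (b + l * d / 32)) := by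
    rw [Real.volume_Ioo]
    refine ENNReal.ofReal_le_ofReal ?_
    have : 0 < l * d := by positivity
    linarith
  rw [sq, mul_assoc]
  refine (mul_le_mul_left hdev _).trans ?_
  refine hu.mul_volume_le_lintegral hs (measurableSet_deviationSet _ _ _ _ _)
    (fun t ht => ha ht.1) fun s hs' => ?_
  refine (mul_le_mul_left hb' _).trans ?_
  refine hu.mul_volume_le_lintegral hs measurableSet_Ioo hb fun t ht => ?_
  exact inv_rpow_le_inv_rpow hp
    (tangentPointRadius_le_of_mem_deviationSet hs hd hl hl1 h1 h2 ha hv (hw t ht) hs')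

/-- Lower bound for the symmetrized tangent-point energy. -/
theorem IsUnitLoop.le_energyTPSym (hs : IsSimpleClosed γ) (hu : IsUnitLoop γ) {p : ℝ} (hp : 0 ≤ p)
    {d l a b : ℝ} {v w : E3}
    (hd : 0 < d) (hl : 0 < l) (hl1 : l ≤ 1) (h1 : d / 8 ≤ ‖w - v‖) (h2 : ‖w - v‖ ≤ 3 / 2 * d)
    (ha : Ioo a (a + l * d / 32) ⊆ Ioo 0 1)
    (hv : ∀ t ∈ Ioo a (a + l * d / 32), ‖γ t - v‖ ≤ l * d / 32)
    (hb : Ioo b (b + l * d / 32) ⊆ Ioo 0 1)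
    (hw : ∀ t ∈ Ioo b (b + l * d / 32), ‖γ t - w‖ ≤ l * d / 32)
    (hdev : ENNReal.ofReal (l * d / 32 / 2) ≤
      volume (deviationSet γ a (l * d / 32) (w - v) l))
    (hdev' : ENNReal.ofReal (l * d / 32 / 2) ≤
      volume (deviationSet γ b (l * d / 32) (v - w) l)) :
    ENNReal.ofReal (l * d / 32 / 2) ^ 2 * (ENNReal.ofReal ((1 / 2 * (l / d))⁻¹) ^ p)⁻¹ ≤
      energyTPSym p γ := by
  rw [sq, mul_assoc]
  refine (mul_le_mul_left hdev _).trans ?_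
  refine hu.mul_volume_le_lintegral hs (measurableSet_deviationSet _ _ _ _ _)
    (fun t ht => ha ht.1) fun s hs' => ?_
  refine (mul_le_mul_left hdev' _).trans ?_
  refine hu.mul_volume_le_lintegral hs (measurableSet_deviationSet _ _ _ _ _)
    (fun t ht => hb ht.1) fun t ht => ?_
  have e1 := tangentPointRadius_le_of_mem_deviationSet hs hd hl hl1 h1 h2 ha hv (hw t ht.1) hs'
  rw [norm_sub_rev] at h1 h2
  have e2 := tangentPointRadius_le_of_mem_deviationSet hs hd hl hl1 h1 h2 hb hw (hv s hs'.1) ht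
  have e3 : ENNReal.ofReal ((1 / 2 * (l / d))⁻¹) ^ p =
      (ENNReal.ofReal ((1 / 2 * (l / d))⁻¹) * ENNReal.ofReal ((1 / 2 * (l / d))⁻¹)) ^ (p / 2) := by
    rw [← sq, ← ENNReal.rpow_natCast, ← ENNReal.rpow_mul]
    congr 1
    push_cast; ring
  rw [e3]
  exact inv_rpow_le_inv_rpow (by positivity) (mul_le_mul' e1 e2)

end

/-- At low energy, tangents on more than half of the arc at `x` follow `y - x`, and likewise `z -
x`. This gives `θ ≤ 2 * l`, which `l = θ / 3` contradicts. -/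
theorem finitelyManyKnotTypes_energyTP {p : ℝ} (hp : 2 < p) :
    FinitelyManyKnotTypes (energyTP p) := by
  refine finitelyManyKnotTypes_of_le_energy (n := 2) (a := 1 / 3 / 64) (b := 1 / 2 / 3)
    (by norm_num) (by norm_num) (by exact_mod_cast hp) ?_
  intro γ hγ hu x hx y hy z hz d hd hyx hd1 hzx hzx' θ hθ hs
  have hθ1 : θ ≤ 1 := hs ▸ sinAngle_le_one _ _
  set l : ℝ := θ / 3 with hl
  have hl0 : 0 < l := by positivity
  have hl1 : l ≤ 1 := by linarith
  have hld : l * d ≤ 1 := by nlinarith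
  have hh0 : 0 < l * d / 32 := by positivity
  have hh : l * d / 32 ≤ 1 / 2 := by linarith
  obtain ⟨a, ha, hax⟩ := hu.exists_Ioo hx hh0 hh
  obtain ⟨b, hb, hby⟩ := hu.exists_Ioo hy hh0 hh
  obtain ⟨c, hc, hcz⟩ := hu.exists_Ioo hz hh0 hh
  have e1 : 1 / 3 / 64 * (θ * d) = l * d / 32 / 2 := by rw [hl]; ring
  have e2 : 1 / 2 / 3 * (θ / d) = 1 / 2 * (l / d) := by rw [hl]; ring
  rw [e1, e2]
  by_contra! hcon
  have hxy : volume (deviationSet γ a (l * d / 32) (y - x) l) < ENNReal.ofReal (l * d / 32 / 2) := by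
    by_contra! hdev
    exact hcon.not_ge (hu.le_energyTP hγ (by linarith) hd hl0 hl1 (by linarith) (by linarith)
      ha hax hb hby hdev)
  have hxz : volume (deviationSet γ a (l * d / 32) (z - x) l) < ENNReal.ofReal (l * d / 32 / 2) := by
    by_contra! hdev
    exact hcon.not_ge (hu.le_energyTP hγ (by linarith) hd hl0 hl1 (by linarith) (by linarith)
      ha hax hc hcz hdev)
  have := hu.sinAngle_le_of_volume_lt ha hxy hxz
  rw [hs] at this
  linarith

/-- In a triangle with comparable sides, the sines of the angles are comparable. -/
theorem sinAngle_le_of_comparable {x y z : E3} {d s : ℝ} (hd : 0 < d)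
    (hyx : d / 8 ≤ ‖y - x‖) (hzx : ‖z - x‖ ≤ 3 / 2 * d)
    (hzy : d / 8 ≤ ‖z - y‖) (h : sinAngle (y - x) (z - x) ≤ s) :
    sinAngle (x - y) (z - y) ≤ 12 * s := by
  have hxy : x ≠ y := (sub_ne_zero.1 (norm_pos_iff.1 (lt_of_lt_of_le (by positivity) hyx))).symm
  have h1 := sinAngle_mul_norm_eq x y z hxy
  have h2 := sinAngle_nonneg (y - x) (z - x)
  have h3 := sinAngle_nonneg (x - y) (z - y)
  have h4 : sinAngle (x - y) (z - y) * (d / 8) ≤ s * (3 / 2 * d) := by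
    calc _ ≤ sinAngle (x - y) (z - y) * ‖z - y‖ := by gcongr
      _ = sinAngle (y - x) (z - x) * ‖z - x‖ := h1.symm
      _ ≤ s * (3 / 2 * d) := by gcongr; exact h2.trans h
  nlinarith

/-- Low energy makes the tangents follow each edge at one end at least. A triangle could be oriented
cyclically without a conflict; the six edges on four points cannot. -/
theorem finitelyManyKnotTypes_energyTPSym {p : ℝ} (hp : 2 < p) :
    FinitelyManyKnotTypes (energyTPSym p) := by
  refine finitelyManyKnotTypes_of_le_energy (n := 2) (a := 1 / 600 / 64) (b := 1 / 2 / 600)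
    (by norm_num) (by norm_num) (by exact_mod_cast hp) ?_
  intro γ hγ hu x hx y hy z hz d hd hyx hd1 hzx hzx' θ hθ hs
  have hθ1 : θ ≤ 1 := hs ▸ sinAngle_le_one _ _
  -- Two near collinearities add up to `48 * l`, and the transfer to another vertex costs a factor
  -- `12`: `576 * l < θ`.
  set l : ℝ := θ / 600 with hl
  have hl0 : 0 < l := by positivity
  have hl1 : l ≤ 1 := by linarith
  have hld : l * d ≤ 1 := by nlinarith
  have hh0 : 0 < l * d / 32 := by positivity
  have hh : l * d / 32 ≤ 1 / 2 := by linarith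
  -- The fourth point is so close to `x` that its distances to `y` and `z` are still at least `d /
  -- 8`.
  obtain ⟨w, hw, hwx⟩ := IsPreconnected.exists_norm_sub_eq
    (isPreconnected_Icc.image γ hγ.continuousOn) hx hy (ρ := d / 8) (by positivity) (by linarith)
  have e1 : 1 / 600 / 64 * (θ * d) = l * d / 32 / 2 := by rw [hl]; ring
  have e2 : 1 / 2 / 600 * (θ / d) = 1 / 2 * (l / d) := by rw [hl]; ring
  rw [e1, e2]
  by_contra! hcon
  obtain ⟨a, ha, hax⟩ := hu.exists_Ioo hx hh0 hh
  obtain ⟨b, hb, hby⟩ := hu.exists_Ioo hy hh0 hh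
  obtain ⟨c, hc, hcz⟩ := hu.exists_Ioo hz hh0 hh
  obtain ⟨e, he, hew⟩ := hu.exists_Ioo hw hh0 hh
  -- the pairwise distances
  have dyx : d / 8 ≤ ‖y - x‖ ∧ ‖y - x‖ ≤ 3 / 2 * d := by constructor <;> linarith
  have dzx : d / 8 ≤ ‖z - x‖ ∧ ‖z - x‖ ≤ 3 / 2 * d := by constructor <;> linarith
  have dwx : d / 8 ≤ ‖w - x‖ ∧ ‖w - x‖ ≤ 3 / 2 * d := by constructor <;> linarith
  have dist_bounds : ∀ p q : E3, ‖p - x‖ - ‖q - x‖ ≤ ‖p - q‖ ∧ ‖p - q‖ ≤ ‖p - x‖ + ‖q - x‖ := by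
    intro p q
    have h1 := norm_sub_le (p - x) (q - x)
    have h2 := norm_sub_norm_le (p - x) (q - x)
    rw [sub_sub_sub_cancel_right] at h1 h2
    exact ⟨h2, h1⟩
  have dyz : d / 8 ≤ ‖y - z‖ ∧ ‖y - z‖ ≤ 3 / 2 * d := by
    obtain ⟨h1, h2⟩ := dist_bounds y z
    constructor <;> linarith
  have dyw : d / 8 ≤ ‖y - w‖ ∧ ‖y - w‖ ≤ 3 / 2 * d := by
    obtain ⟨h1, h2⟩ := dist_bounds y w
    constructor <;> linarith
  have dzw : d / 8 ≤ ‖z - w‖ ∧ ‖z - w‖ ≤ 3 / 2 * d := by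
    obtain ⟨h1, h2⟩ := dist_bounds z w
    constructor <;> linarith
  have flip : ∀ {p q : E3}, (d / 8 ≤ ‖p - q‖ ∧ ‖p - q‖ ≤ 3 / 2 * d) →
      (d / 8 ≤ ‖q - p‖ ∧ ‖q - p‖ ≤ 3 / 2 * d) := fun {p q} h => by rwa [norm_sub_rev]
  -- at one end of every edge the tangents follow the edge
  set cov : ℝ → E3 → E3 → Prop := fun a v w =>
    volume (deviationSet γ a (l * d / 32) (w - v) l) < ENNReal.ofReal (l * d / 32 / 2) with hcov
  have edge : ∀ {a b : ℝ} {v w : E3}, Ioo a (a + l * d / 32) ⊆ Ioo 0 1 →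
      (∀ t ∈ Ioo a (a + l * d / 32), ‖γ t - v‖ ≤ l * d / 32) → Ioo b (b + l * d / 32) ⊆ Ioo 0 1 →
      (∀ t ∈ Ioo b (b + l * d / 32), ‖γ t - w‖ ≤ l * d / 32) →
      (d / 8 ≤ ‖w - v‖ ∧ ‖w - v‖ ≤ 3 / 2 * d) → cov a v w ∨ cov b w v := by
    intro a b v w ha hv hb hw hvw
    by_contra! h
    exact hcon.not_ge (hu.le_energyTPSym hγ (by linarith) hd hl0 hl1 hvw.1 hvw.2 ha hv hb hw
      (not_lt.1 h.1) (not_lt.1 h.2))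
  -- near collinearity of triples
  set col : E3 → E3 → E3 → Prop := fun p q r => sinAngle (q - p) (r - p) ≤ 24 * l ∧
    sinAngle (p - q) (r - q) ≤ 24 * l ∧ sinAngle (p - r) (q - r) ≤ 24 * l with hcol
  have vertex : ∀ {a : ℝ} {p q r : E3}, Ioo a (a + l * d / 32) ⊆ Ioo 0 1 →
      (d / 8 ≤ ‖q - p‖ ∧ ‖q - p‖ ≤ 3 / 2 * d) → (d / 8 ≤ ‖r - p‖ ∧ ‖r - p‖ ≤ 3 / 2 * d) →
      (d / 8 ≤ ‖r - q‖ ∧ ‖r - q‖ ≤ 3 / 2 * d) → cov a p q → cov a p r → col p q r := by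
    intro a p q r ha hqp hrp hrq h1 h2
    have h3 := hu.sinAngle_le_of_volume_lt ha h1 h2
    refine ⟨by linarith, ?_, ?_⟩
    · have := sinAngle_le_of_comparable hd hqp.1 hrp.2 hrq.1 h3
      linarith
    · rw [sinAngle_comm] at h3
      have := sinAngle_le_of_comparable hd hrp.1 hqp.2 (flip hrq).1 h3
      linarith
  have swap12 : ∀ {p q r : E3}, col p q r → col q p r := fun {p q r} h =>
    ⟨h.2.1, h.1, by rw [sinAngle_comm]; exact h.2.2⟩
  have swap23 : ∀ {p q r : E3}, col p q r → col p r q := fun {p q r} h =>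
    ⟨by rw [sinAngle_comm]; exact h.1, h.2.2, h.2.1⟩
  have n1 : ¬col x y z := fun h => by
    have := h.1
    rw [hs] at this
    linarith
  have n2 : ¬(col x y w ∧ col x z w) := fun ⟨h, h'⟩ => by
    have h1 := h.1
    have h2 := h'.1
    have := sinAngle_triangle (y - x) (w - x) (z - x)
    rw [sinAngle_comm (w - x)] at this
    linarith
  have n3 : ¬(col x y w ∧ col y z w) := fun ⟨h, h'⟩ => by
    have h1 := h.2.1
    have h2 := h'.1
    have h3 := sinAngle_triangle (x - y) (w - y) (z - y)
    rw [sinAngle_comm (w - y)] at h3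
    have := sinAngle_le_of_comparable hd (flip dyx).1 (flip dyz).2 dzx.1
      (s := 48 * l) (by linarith)
    linarith
  have n4 : ¬(col x z w ∧ col y z w) := fun ⟨h, h'⟩ => by
    have h1 := h.2.1
    have h2 := h'.2.1
    have h3 := sinAngle_triangle (x - z) (w - z) (y - z)
    rw [sinAngle_comm (w - z)] at h3
    have := sinAngle_le_of_comparable hd (flip dzx).1 dyz.2 dyx.1
      (s := 48 * l) (by linarith)
    rw [sinAngle_comm] at this
    linarith
  have hxy := edge ha hax hb hby dyx
  have hxz := edge ha hax hc hcz dzx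
  have hxw := edge ha hax he hew dwx
  have hyz := edge hb hby hc hcz (flip dyz)
  have hyw := edge hb hby he hew (flip dyw)
  have hzw := edge hc hcz he hew (flip dzw)
  have x1 := vertex ha dyx dzx (flip dyz)
  have x2 := vertex ha dyx dwx (flip dyw)
  have x3 := vertex ha dzx dwx (flip dzw)
  have y1 : cov b y x → cov b y z → col x y z := fun h h' =>
    swap12 (vertex hb (flip dyx) (flip dyz) dzx h h')
  have y2 : cov b y x → cov b y w → col x y w := fun h h' =>
    swap12 (vertex hb (flip dyx) (flip dyw) dwx h h')
  have y3 := vertex hb (flip dyz) (flip dyw) (flip dzw)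
  have z1 : cov c z x → cov c z y → col x y z := fun h h' =>
    swap23 (swap12 (vertex hc (flip dzx) dyz dyx h h'))
  have z2 : cov c z x → cov c z w → col x z w := fun h h' =>
    swap12 (vertex hc (flip dzx) (flip dzw) dwx h h')
  have z3 : cov c z y → cov c z w → col y z w := fun h h' =>
    swap12 (vertex hc dyz (flip dzw) (flip dyw) h h')
  have w1 : cov e w x → cov e w y → col x y w := fun h h' =>
    swap23 (swap12 (vertex he (flip dwx) dyw dyx h h'))
  have w2 : cov e w x → cov e w z → col x z w := fun h h' =>
    swap23 (swap12 (vertex he (flip dwx) dzw dzx h h'))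
  have w3 : cov e w y → cov e w z → col y z w := fun h h' =>
    swap23 (swap12 (vertex he dyw dzw (flip dyz) h h'))
  clear_value cov col
  clear hcov hcol edge vertex swap12 swap23
  -- Assign each edge to one end where it is followed. A vertex with three edges makes three triples
  -- nearly collinear, which `n1` to `n4` exclude; so at least two vertices have two edges each.
  -- Only one triple can be nearly collinear, so these four distinct edges would all lie in one
  -- triangle.
  grind

end MengerKnot

theorem mainTheorem6 (p : ℝ) :
    (3 < p → MengerKnot.FinitelyManyKnotTypes (MengerKnot.energyM p)) ∧
    (2 < p → MengerKnot.FinitelyManyKnotTypes (MengerKnot.energyI p)) ∧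
    (1 < p → MengerKnot.FinitelyManyKnotTypes (MengerKnot.energyU p)) ∧
    (2 < p → MengerKnot.FinitelyManyKnotTypes (MengerKnot.energyTP p)) ∧
    (2 < p → MengerKnot.FinitelyManyKnotTypes (MengerKnot.energyTPSym p)) :=
  ⟨MengerKnot.finitelyManyKnotTypes_energyM, MengerKnot.finitelyManyKnotTypes_energyI,
    MengerKnot.finitelyManyKnotTypes_energyU, MengerKnot.finitelyManyKnotTypes_energyTP,
    MengerKnot.finitelyManyKnotTypes_energyTPSym⟩
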